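/- **Setting.** There are $n\ge 1$ resources with average budgets $\rho=(\rho^i)_{i\le n}\in(0,1]^n$, $\rho_{\min}=\min_i\rho^i$, and $T\ge 1$ rounds. In round $t$ an agent sees a request type $\theta_t\in\Theta$, drawn i.i.d. from $\mathcal U$, and chooses $a_t\in\{0,1\}$; with an external factor $\gamma_t\in\Gamma$, drawn i.i.d. from $\mathcal V$ (independently of the types), she receives the reward $r(\theta_t,a_t,\gamma_t)\in[0,1]$ and pays the consumption $c(\theta_t,a_t,\gamma_t)\in[0,1]^n$, both zero when $a_t=0$. Put $R(\theta)=\mathbb E_\gamma[r(\theta,1,\gamma)]$, $C(\theta)=\mathbb E_\gamma[c(\theta,1,\gamma)]$, $$J(\kappa)=\max_{\phi:\Theta\to[0,1]}\mathbb E_\theta[R(\theta)\phi(\theta)]\quad\text{s.t.}\quad \mathbb E_\theta[C(\theta)\phi(\theta)]\le\kappa,$$ and let the fluid benchmark be $F=T\cdot J(\rho)$. **Re-solving heuristic.** Start with $B_1=\rho T$. In round $t$ put $\rho_t=B_t/(T-t+1)$; form estimates $\hat{\mathcal U}_t,\hat{\mathcal V}_t$ of $\mathcal U,\mathcal V$ from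 the observed history of the previous $t-1$ rounds (any estimation procedure; $\gamma_s$ is observed either in every round $s$, or exactly in those with $a_s=1$); let $\hat\phi_t$ be an optimal solution of the program defining $J(\rho_t)$ with $\hat{\mathcal U}_t,\hat{\mathcal V}_t$ in place of $\mathcal U,\mathcal V$; choose $a_t=1$ with probability $\hat\phi_t(\theta_t)$; put $B_{t+1}=B_t-c(\theta_t,a_t,\gamma_t)$, and stop if $B_{t+1}^i<1$ for some $i$. Let $T_0\le T$ be the last round played. In rounds $t>T_0$ the null action is taken, so that $B_t$ stays constant and $\hat\phi_t:=0$. Let $Rew=\mathbb E\big[\sum_{t=1}^{T_0}r(\theta_t,a_t,\gamma_t)\big]$. **Assumptions.** Let $E_t^C=\dfrac{\rho_t-\mathbb E_\theta[\hat\phi_t(\theta)C(\theta)]}{T-t}$ and $E_t^R=J(\rho_t)-\mathbb E_\theta[\hat\phi_t(\theta)R(\theta)]$. Suppose that 1. there are nonnegative numbers $f_E^C(t,\epsilon)\ge 0$ ($1\le t\le T-1$, $\epsilon>0$) with $$\Pr\Big[\min_{i\le n}\ \sum_{\tau=1}^{t-1}(E_\tau^C)^i\le -f_E^C(t,\epsilon)\Big]\le\epsilon\qquad\text{for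 all such }t,\epsilon;$$ 2. there is a number $f_E^R(T)$ with $\mathbb E\big[\sum_{t=1}^{T_0}E_t^R\big]\le f_E^R(T)$. **Conclusion.** There are positive constants $C_1,C_2$, depending only on $\rho_{\min}$, such that $$F-Rew\ \le\ C_1\Big(\sum_{t=1}^{T-1}f_E^C(t)+2\sqrt{2T\ln T}+n\Big)+C_2\,g(T)+f_E^R(T),$$ where $f_E^C(t)=\inf_{\epsilon>0}\{f_E^C(t,\epsilon)+\epsilon\}$ and $$g(T)=\inf\Big\{T-\Big(1-\epsilon-\frac nT\Big)t\ :\ 1\le t\le T-1,\ \epsilon>0,\ f_E^C(t,\epsilon)+\sqrt{\frac{2\ln T}{T-t}}\le\rho_{\min}-\frac1{T-t+1}\Big\},$$ with $g(T)=+\infty$ if no pair $(t,\epsilon)$ is admissible. -/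

import Mathlib

open MeasureTheory ProbabilityTheory

namespace CBwK

/-- A (binary) contextual bandit-with-knapsacks environment with `n` resources: request types in
`Θ`, drawn from `U`; external factors in `Γ`, drawn from `V`; and known reward and consumption
functions. The active action is `true`, the null action is `false`. -/
structure Environment (n : ℕ) (Θ Γ : Type*) [MeasurableSpace Θ] [MeasurableSpace Γ] where
  U : Measure Θ
  V : Measure Γ
  probU : IsProbabilityMeasure U
  probV : IsProbabilityMeasure V
  r : Θ → Bool → Γ → ℝ
  c : Θ → Bool → Γ → Fin n → ℝ
  measurable_r : ∀ a, Measurable fun p : Θ × Γ => r p.1 a p.2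
  measurable_c : ∀ a i, Measurable fun p : Θ × Γ => c p.1 a p.2 i
  r_mem : ∀ θ a γ, r θ a γ ∈ Set.Icc (0 : ℝ) 1
  c_mem : ∀ θ a γ i, c θ a γ i ∈ Set.Icc (0 : ℝ) 1
  r_null : ∀ θ γ, r θ false γ = 0
  c_null : ∀ θ γ i, c θ false γ i = 0

/-- Feedback models: the external factor is revealed in every round (`full`), or exactly in the
rounds in which the active action is chosen (`activeOnly`, that is, partial information). -/
inductive Feedback
  | full
  | activeOnly

/-- What the agent records in one round: the request type, the action, and the external factor
if it is revealed (`Sum.inl γ`) or nothing (`Sum.inr ()`). -/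
abbrev Obs (Θ Γ : Type*) := Θ × Bool × (Γ ⊕ Unit)

/-- What is revealed about the external factor. -/
def Feedback.reveal {Γ : Type*} : Feedback → Bool → Γ → Γ ⊕ Unit
  | .full, _, γ => Sum.inl γ
  | .activeOnly, true, γ => Sum.inl γ
  | .activeOnly, false, _ => Sum.inr ()

section

variable {n : ℕ} {Θ Γ : Type*} [MeasurableSpace Θ] [MeasurableSpace Γ]

namespace Environment

variable (M : Environment n Θ Γ)

/-- Expected reward `R(θ)` of the active action. -/
noncomputable def R (θ : Θ) : ℝ := ∫ γ, M.r θ true γ ∂M.V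

/-- Expected consumption `C(θ)` of the active action. -/
noncomputable def C (θ : Θ) (i : Fin n) : ℝ := ∫ γ, M.c θ true γ i ∂M.V

/-- The value of the fluid program: maximize `E[R φ]` over measurable `φ : Θ → [0, 1]` subject to
`E[C φ] ≤ κ`. -/
noncomputable def J (κ : Fin n → ℝ) : ℝ :=
  sSup {x : ℝ | ∃ φ : Θ → ℝ, Measurable φ ∧ (∀ θ, φ θ ∈ Set.Icc (0 : ℝ) 1) ∧
    (∀ i, ∫ θ, M.C θ i * φ θ ∂M.U ≤ κ i) ∧ x = ∫ θ, M.R θ * φ θ ∂M.U}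

/-- The fluid benchmark for `T` rounds with average budget `ρ`. -/
noncomputable def fluid (ρ : Fin n → ℝ) (T : ℕ) : ℝ := T * M.J ρ

/-- `φ` is feasible for the estimated program, in which `Uh`, `Vh` replace `U`, `V`. The estimates
are signed measures, so that empirical distributions and estimated densities that may take
negative values (kernel estimates of higher order) are both allowed. -/
def EstFeasible (Uh : SignedMeasure Θ) (Vh : SignedMeasure Γ) (κ : Fin n → ℝ) (φ : Θ → ℝ) : Prop :=
  Measurable φ ∧ (∀ θ, φ θ ∈ Set.Icc (0 : ℝ) 1) ∧
    ∀ i, (∫ᵛ θ, (∫ᵛ γ, M.c θ true γ i ∂<•Vh) * φ θ ∂<•Uh) ≤ κ i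

/-- Objective of the estimated program. -/
noncomputable def estValue (Uh : SignedMeasure Θ) (Vh : SignedMeasure Γ) (φ : Θ → ℝ) : ℝ :=
  ∫ᵛ θ, (∫ᵛ γ, M.r θ true γ ∂<•Vh) * φ θ ∂<•Uh

/-- `φ` is an optimal solution of the estimated program. -/
def IsEstSolution (Uh : SignedMeasure Θ) (Vh : SignedMeasure Γ) (κ : Fin n → ℝ)
    (φ : Θ → ℝ) : Prop :=
  M.EstFeasible Uh Vh κ φ ∧ ∀ ψ, M.EstFeasible Uh Vh κ ψ → M.estValue Uh Vh ψ ≤ M.estValue Uh Vh φ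

end Environment

/-- The data that turn the re-solving heuristic into a concrete algorithm: how the two
distributions are estimated from the record `h` of the `k` completed rounds, and which optimal
solution `sol k κ h` of the resulting estimated program is used when the average remaining budget
is `κ`. -/
structure Resolver (M : Environment n Θ Γ) where
  estU : ∀ k : ℕ, (Fin k → Obs Θ Γ) → SignedMeasure Θ
  estV : ∀ k : ℕ, (Fin k → Obs Θ Γ) → SignedMeasure Γ
  sol : ∀ k : ℕ, (Fin n → ℝ) → (Fin k → Obs Θ Γ) → Θ → ℝ
  measurable_sol : ∀ k, Measurable
    fun p : (Fin n → ℝ) × (Fin k → Obs Θ Γ) × Θ => sol k p.1 p.2.1 p.2.2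
  isSolution : ∀ k κ h, (∀ i, 0 < κ i) → M.IsEstSolution (estU k h) (estV k h) κ (sol k κ h)

/-- The state of the algorithm after `k` rounds. -/
structure RunState (n : ℕ) (Θ Γ : Type*) (k : ℕ) where
  hist : Fin k → Obs Θ Γ
  budget : Fin n → ℝ
  running : Prop

/-- The randomness of one round: request type, external factor, and a uniform number in `[0, 1]`
that is used to draw the action. -/
abbrev Draw (Θ Γ : Type*) := Θ × Γ × unitInterval

/-- The law of the independent draws; the draw of index `t` is used in round `t ≥ 1`. -/
noncomputable def Environment.law (M : Environment n Θ Γ) : Measure (ℕ → Draw Θ Γ) :=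
  haveI := M.probU
  haveI := M.probV
  Measure.infinitePi fun _ : ℕ => M.U.prod (M.V.prod (volume : Measure unitInterval))

namespace Resolver

variable {M : Environment n Θ Γ} (A : Resolver M) (fb : Feedback) (ρ : Fin n → ℝ) (T : ℕ)

/-- Given the state `s` after `k` rounds, the average remaining budget in round `k + 1`. -/
noncomputable def nextRho {k : ℕ} (s : RunState n Θ Γ k) (i : Fin n) : ℝ :=
  s.budget i / ((T : ℝ) - k)

open Classical in
/-- Given the state `s` after `k` rounds, the probability with which a request of type `θ` in
round `k + 1` is answered by the active action. A stopped algorithm takes the null action. -/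
noncomputable def nextProb {k : ℕ} (s : RunState n Θ Γ k) (θ : Θ) : ℝ :=
  if s.running then A.sol k (nextRho T s) s.hist θ else 0

open Classical in
/-- Given the state `s` after `k` rounds and the draw of round `k + 1`, the action taken. -/
noncomputable def nextAction {k : ℕ} (s : RunState n Θ Γ k) (d : Draw Θ Γ) : Bool :=
  decide ((d.2.2 : ℝ) < A.nextProb T s d.1)

/-- One round of the algorithm. It stops when some remaining budget falls below `1`. -/
noncomputable def step {k : ℕ} (s : RunState n Θ Γ k) (d : Draw Θ Γ) : RunState n Θ Γ (k + 1) :=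
  let a := A.nextAction T s d
  let B := fun i => s.budget i - M.c d.1 a d.2.1 i
  { hist := Fin.snoc s.hist (d.1, a, fb.reveal a d.2.1)
    budget := B
    running := s.running ∧ ∀ i, 1 ≤ B i }

/-- The state of the algorithm after `k` rounds on the sample path `ω`. -/
noncomputable def run (ω : ℕ → Draw Θ Γ) : (k : ℕ) → RunState n Θ Γ k
  | 0 => { hist := Fin.elim0, budget := fun i => ρ i * T, running := True }
  | k + 1 => A.step fb T (run ω k) (ω (k + 1))

/-- The average remaining budget `ρ_t = B_t / (T - t + 1)` at the start of round `t ≥ 1`. -/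
noncomputable def rho (ω : ℕ → Draw Θ Γ) (t : ℕ) (i : Fin n) : ℝ :=
  (A.run fb ρ T ω (t - 1)).budget i / ((T : ℝ) - t + 1)

/-- The probability of the active action in round `t ≥ 1`, as a function of the request type:
the chosen optimal solution of the estimated program, and `0` once the algorithm has stopped. -/
noncomputable def prob (ω : ℕ → Draw Θ Γ) (t : ℕ) (θ : Θ) : ℝ :=
  A.nextProb T (A.run fb ρ T ω (t - 1)) θ

/-- The action in round `t ≥ 1`. -/
noncomputable def action (ω : ℕ → Draw Θ Γ) (t : ℕ) : Bool :=
  A.nextAction T (A.run fb ρ T ω (t - 1)) (ω t)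

/-- The stopping time `T₀`: the first round after which some remaining budget is below `1`, or
`T` if there is none before. -/
noncomputable def stopTime (ω : ℕ → Draw Θ Γ) : ℕ :=
  sInf {t : ℕ | 1 ≤ t ∧ (t = T ∨ ∃ i, (A.run fb ρ T ω t).budget i < 1)}

/-- The expected accumulated reward. -/
noncomputable def expReward : ℝ :=
  ∫ ω, ∑ t ∈ Finset.Icc 1 (A.stopTime fb ρ T ω),
    M.r (ω t).1 (A.action fb ρ T ω t) (ω t).2.1 ∂M.law

/-- The consumption estimation error of round `t`:
`(ρ_t - E_θ[φ_t(θ) C(θ)]) / (T - t)`, where `φ_t` is the probability of the active action. -/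
noncomputable def consumptionError (ω : ℕ → Draw Θ Γ) (t : ℕ) (i : Fin n) : ℝ :=
  (A.rho fb ρ T ω t i - ∫ θ, A.prob fb ρ T ω t θ * M.C θ i ∂M.U) / ((T : ℝ) - t)

/-- The reward estimation error of round `t`: `J(ρ_t) - E_θ[φ_t(θ) R(θ)]`. -/
noncomputable def rewardError (ω : ℕ → Draw Θ Γ) (t : ℕ) : ℝ :=
  M.J (A.rho fb ρ T ω t) - ∫ θ, A.prob fb ρ T ω t θ * M.R θ ∂M.U

/-- With probability at least `1 - ε`, the smallest entry of the consumption estimation error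
accumulated before round `t` exceeds `-err t ε`. -/
def ConsumptionErrorBound (err : ℕ → ℝ → ℝ) : Prop :=
  ∀ t ∈ Finset.Icc 1 (T - 1), ∀ ε : ℝ, 0 < ε →
    M.law.real {ω | ⨅ i, ∑ τ ∈ Finset.Icc 1 (t - 1), A.consumptionError fb ρ T ω τ i ≤ -err t ε}
      ≤ ε

/-- The expected accumulated reward estimation error up to the stopping time is at most `b`. -/
def RewardErrorBound (b : ℝ) : Prop :=
  ∫ ω, ∑ t ∈ Finset.Icc 1 (A.stopTime fb ρ T ω), A.rewardError fb ρ T ω t ∂M.law ≤ b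

end Resolver

end

/-- `f_E^C(t)`: the infimum of `err t ε + ε` over `ε > 0`. -/
noncomputable def errInf (err : ℕ → ℝ → ℝ) (t : ℕ) : ℝ :=
  ⨅ ε : Set.Ioi (0 : ℝ), (err t ε + ε)

/-- `g(T)`: the infimum of `T - (1 - ε - n / T) t` over all rounds `t < T` and all `ε > 0` with
`err t ε + √(2 ln T / (T - t)) ≤ ρmin - 1 / (T - t + 1)`. It is `⊤` if there is no such pair. For
`t = T` the left-hand side of the constraint is read as infinite. -/
noncomputable def earlyStop (n : ℕ) (ρmin : ℝ) (err : ℕ → ℝ → ℝ) (T : ℕ) : EReal :=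
  sInf {x : EReal | ∃ (t : ℕ) (ε : ℝ), 1 ≤ t ∧ t < T ∧ 0 < ε ∧
    err t ε + √(2 * Real.log T / ((T : ℝ) - t)) ≤ ρmin - 1 / ((T : ℝ) - t + 1) ∧
    x = (((T : ℝ) - (1 - ε - (n : ℝ) / T) * t : ℝ) : EReal)}

end CBwK

/-! The regret splits exactly into three terms (`regret_eq`): the expected sum of `J(ρ) - J(ρ_t)`
over the rounds played, `J(ρ)` times the expected number of rounds lost to stopping, and the
expected reward error. The last is bounded by hypothesis, and `J(ρ) ≤ 1`, so only the first two need
work. Both are controlled by one fact: with high probability no entry of `ρ_t` falls far below `ρ`.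

For that, the increment `ρ_{t+1} - ρ_t` is the consumption error of round `t` plus `1 / (T - t)`
times a centred noise, expected minus actual consumption (`nextRho_eq`). Accumulated error is
bounded by hypothesis. Given the past, the noise ranges over an interval of length `1`, so
Hoeffding's lemma bounds its exponential moment; the squared weights before round `t` sum to at most
`1 / (T - t)`, and Chernoff gives the radius `√(2 ln T / (T - t))` with failure probability `1 / T`
per resource (`noiseSum_tail`). A union bound over resources yields failure probability `ε + n / T`
(`prob_nextRho_lt`).

Since `J` is concave with values in `[0, 1]`, a drop of budget rates by `δ` costs at most `δ / ρmin`
(`J_sub_le`); summing over rounds gives the `C₁` term (`sum_runLoss_le`). If the lower bound on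
`ρ_t` is at least `1 / (T - t + 1)`, all budgets are at least `1`, so round `t` is reached; this
gives the `g(T)` term (`sum_not_running_le`).

The quality of the estimates enters only through the two error hypotheses; of the chosen solutions
the argument uses just measurability and values in `[0, 1]`. Throughout, index `k` counts completed
rounds, so it belongs to round `t = k + 1`. -/

namespace CBwK

/-! ### Resampling one coordinate of an i.i.d. sequence. -/

section Resampling

variable {D : Type*} [MeasurableSpace D] (μ : Measure D) [IsProbabilityMeasure μ]

/-- Resampling one coordinate of an i.i.d. sequence does not change its law. -/
theorem measurePreserving_update_infinitePi (j : ℕ) :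
    MeasurePreserving (fun p : (ℕ → D) × D => Function.update p.1 j p.2)
      ((Measure.infinitePi fun _ : ℕ => μ).prod μ) (Measure.infinitePi fun _ : ℕ => μ) := by
  refine ⟨measurable_update', ?_⟩
  refine Measure.eq_infinitePi _ fun s t ht => ?_
  rw [Measure.map_apply measurable_update' (MeasurableSet.pi s.countable_toSet fun i _ => ht i)]
  by_cases hj : j ∈ s
  · have h : (fun p : (ℕ → D) × D => Function.update p.1 j p.2) ⁻¹' (s : Set ℕ).pi t
        = (((s.erase j : Finset ℕ) : Set ℕ).pi t) ×ˢ t j := by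
      ext ⟨ω, d⟩
      simp only [Set.mem_preimage, Set.mem_pi, Finset.mem_coe, Set.mem_prod, Finset.mem_erase]
      constructor
      · intro h
        refine ⟨fun i hi => ?_, by simpa using h j hj⟩
        simpa [Function.update_of_ne hi.1] using h i hi.2
      · rintro ⟨h1, h2⟩ i hi
        rcases eq_or_ne i j with rfl | hij
        · simpa using h2
        · simpa [Function.update_of_ne hij] using h1 i ⟨hij, hi⟩
    rw [h, Measure.prod_prod, Measure.infinitePi_pi _ fun i _ => ht i, mul_comm,
      Finset.mul_prod_erase s (fun i => μ (t i)) hj]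
  · have h : (fun p : (ℕ → D) × D => Function.update p.1 j p.2) ⁻¹' (s : Set ℕ).pi t
        = ((s : Set ℕ).pi t) ×ˢ Set.univ := by
      ext ⟨ω, d⟩
      simp only [Set.mem_preimage, Set.mem_pi, Finset.mem_coe, Set.mem_prod, Set.mem_univ,
        and_true]
      refine forall₂_congr fun i hi => ?_
      rw [Function.update_of_ne (ne_of_mem_of_not_mem hi hj)]
    rw [h, Measure.prod_prod, Measure.infinitePi_pi _ fun i _ => ht i, measure_univ, mul_one]

/-- This replaces conditional expectation: if the first argument of `f` ignores coordinate `j`, then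
`ω j` may be treated as a fresh draw independent of the past and integrated separately. -/
theorem integral_resample {f : (ℕ → D) × D → ℝ} (hf : Measurable f) {K : ℝ}
    (hK : ∀ p, |f p| ≤ K) (j : ℕ) (hj : ∀ ω d d', f (Function.update ω j d', d) = f (ω, d)) :
    ∫ ω, f (ω, ω j) ∂(Measure.infinitePi fun _ : ℕ => μ)
      = ∫ ω, ∫ d, f (ω, d) ∂μ ∂(Measure.infinitePi fun _ : ℕ => μ) := by
  have hmp := measurePreserving_update_infinitePi μ j
  have hg : Measurable fun ω : ℕ → D => f (ω, ω j) := by fun_prop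
  -- Write the law as the image of the product under the update; the updated coordinate is then `d`,
  -- and `hj` erases the update elsewhere.
  conv_lhs => rw [← hmp.map_eq]
  rw [integral_map hmp.measurable.aemeasurable hg.aestronglyMeasurable]
  simp only [Function.update_self, hj]
  exact integral_prod _ (Integrable.of_bound hf.aestronglyMeasurable K (.of_forall hK))

end Resampling

theorem integrable_of_mem_Icc {α : Type*} [MeasurableSpace α] {μ : Measure α} [IsFiniteMeasure μ]
    {f : α → ℝ} (hf : Measurable f) {a b : ℝ} (h : ∀ x, f x ∈ Set.Icc a b) : Integrable f μ :=
  Integrable.of_mem_Icc a b hf.aemeasurable (.of_forall h)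

theorem integral_mem_unit {α : Type*} [MeasurableSpace α] {μ : Measure α} [IsProbabilityMeasure μ]
    {f : α → ℝ} (hf : Measurable f) (h : ∀ x, f x ∈ Set.Icc (0 : ℝ) 1) :
    ∫ x, f x ∂μ ∈ Set.Icc (0 : ℝ) 1 := by
  refine ⟨integral_nonneg fun x => (h x).1, ?_⟩
  have := integral_mono (integrable_of_mem_Icc (μ := μ) hf h) (integrable_const (1 : ℝ))
    fun x => (h x).2
  simpa using this

theorem mul_mem_unit {x y : ℝ} (hx : x ∈ Set.Icc (0 : ℝ) 1) (hy : y ∈ Set.Icc (0 : ℝ) 1) :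
    x * y ∈ Set.Icc (0 : ℝ) 1 :=
  ⟨mul_nonneg hx.1 hy.1, mul_le_one₀ hx.2 hy.1 hy.2⟩

variable {n : ℕ} {Θ Γ : Type*} [MeasurableSpace Θ] [MeasurableSpace Γ]

/-! ### The fluid program: concavity and stability of its value. -/

namespace Environment

instance (M : Environment n Θ Γ) : IsProbabilityMeasure M.U := M.probU

instance (M : Environment n Θ Γ) : IsProbabilityMeasure M.V := M.probV

variable (M : Environment n Θ Γ)

/-- The law of the draw of one round. -/
noncomputable def drawLaw : Measure (Draw Θ Γ) :=
  M.U.prod (M.V.prod (volume : Measure unitInterval))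

instance : IsProbabilityMeasure M.drawLaw := by unfold drawLaw; infer_instance

theorem law_eq : M.law = Measure.infinitePi fun _ : ℕ => M.drawLaw := rfl

instance : IsProbabilityMeasure M.law := by rw [law_eq]; infer_instance

theorem measurable_R : Measurable M.R :=
  ((M.measurable_r true).stronglyMeasurable.integral_prod_right).measurable

theorem measurable_C (i : Fin n) : Measurable fun θ => M.C θ i :=
  ((M.measurable_c true i).stronglyMeasurable.integral_prod_right).measurable

theorem R_mem (θ : Θ) : M.R θ ∈ Set.Icc (0 : ℝ) 1 :=
  integral_mem_unit ((M.measurable_r true).comp measurable_prodMk_left) fun γ => M.r_mem θ true γ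

theorem C_mem (θ : Θ) (i : Fin n) : M.C θ i ∈ Set.Icc (0 : ℝ) 1 :=
  integral_mem_unit ((M.measurable_c true i).comp measurable_prodMk_left)
    fun γ => M.c_mem θ true γ i

/-- `φ` is feasible for the fluid program. -/
def Feasible (κ : Fin n → ℝ) (φ : Θ → ℝ) : Prop :=
  Measurable φ ∧ (∀ θ, φ θ ∈ Set.Icc (0 : ℝ) 1) ∧ ∀ i, ∫ θ, M.C θ i * φ θ ∂M.U ≤ κ i

/-- Objective of the fluid program. -/
noncomputable def value (φ : Θ → ℝ) : ℝ := ∫ θ, M.R θ * φ θ ∂M.U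

variable {M}

theorem Feasible.value_mem {κ : Fin n → ℝ} {φ : Θ → ℝ} (h : M.Feasible κ φ) :
    M.value φ ∈ Set.Icc (0 : ℝ) 1 :=
  integral_mem_unit (M.measurable_R.mul h.1) fun θ => mul_mem_unit (M.R_mem θ) (h.2.1 θ)

theorem Feasible.value_le_J {κ : Fin n → ℝ} {φ : Θ → ℝ} (h : M.Feasible κ φ) :
    M.value φ ≤ M.J κ := by
  refine le_csSup ⟨1, ?_⟩ ⟨φ, h.1, h.2.1, h.2.2, rfl⟩
  rintro x ⟨ψ, h1, h2, h3, rfl⟩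
  exact (Feasible.value_mem (M := M) (κ := κ) ⟨h1, h2, h3⟩).2

variable (M)

theorem feasible_zero {κ : Fin n → ℝ} (hκ : ∀ i, 0 ≤ κ i) : M.Feasible κ 0 :=
  ⟨measurable_const, fun _ => ⟨le_rfl, zero_le_one⟩, fun i => by simpa using hκ i⟩

theorem J_le {κ : Fin n → ℝ} (hκ : ∀ i, 0 ≤ κ i) {b : ℝ}
    (h : ∀ φ, M.Feasible κ φ → M.value φ ≤ b) : M.J κ ≤ b := by
  obtain ⟨h1, h2, h3⟩ := M.feasible_zero hκ
  refine csSup_le ⟨_, 0, h1, h2, h3, rfl⟩ ?_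
  rintro x ⟨φ, h1, h2, h3, rfl⟩
  exact h φ ⟨h1, h2, h3⟩

theorem J_mem {κ : Fin n → ℝ} (hκ : ∀ i, 0 ≤ κ i) : M.J κ ∈ Set.Icc (0 : ℝ) 1 :=
  ⟨(M.feasible_zero hκ).value_mem.1.trans (M.feasible_zero hκ).value_le_J,
    M.J_le hκ fun _ h => h.value_mem.2⟩

variable {M} in
theorem Feasible.combine {κ κ' : Fin n → ℝ} {φ ψ : Θ → ℝ} (hφ : M.Feasible κ φ)
    (hψ : M.Feasible κ' ψ) {a b : ℝ} (ha : 0 ≤ a) (hb : 0 ≤ b) (hab : a + b = 1) :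
    M.Feasible (a • κ + b • κ') (a • φ + b • ψ)
      ∧ M.value (a • φ + b • ψ) = a * M.value φ + b * M.value ψ := by
  have key : ∀ f : Θ → ℝ, Measurable f → (∀ θ, f θ ∈ Set.Icc (0 : ℝ) 1) →
      ∫ θ, f θ * (a • φ + b • ψ) θ ∂M.U
        = a * ∫ θ, f θ * φ θ ∂M.U + b * ∫ θ, f θ * ψ θ ∂M.U := by
    intro f hf hf1
    rw [← integral_const_mul, ← integral_const_mul, ← integral_add]
    · congr 1 with θ
      simp only [Pi.add_apply, Pi.smul_apply, smul_eq_mul]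
      ring
    · exact (integrable_of_mem_Icc (hf.mul hφ.1)
        fun θ => mul_mem_unit (hf1 θ) (hφ.2.1 θ)).const_mul a
    · exact (integrable_of_mem_Icc (hf.mul hψ.1)
        fun θ => mul_mem_unit (hf1 θ) (hψ.2.1 θ)).const_mul b
  refine ⟨⟨(hφ.1.const_smul a).add (hψ.1.const_smul b), fun θ => ?_, fun i => ?_⟩,
    key _ M.measurable_R M.R_mem⟩
  · exact (convex_Icc (0 : ℝ) 1) (hφ.2.1 θ) (hψ.2.1 θ) ha hb hab
  · rw [key _ (M.measurable_C i) fun θ => M.C_mem θ i]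
    have h1 := mul_le_mul_of_nonneg_left (hφ.2.2 i) ha
    have h2 := mul_le_mul_of_nonneg_left (hψ.2.2 i) hb
    simpa using add_le_add h1 h2

/-- A mixture of feasible policies is feasible for the mixed budget, with mixed value. Attainment of
the supremum is not assumed, so the two suprema are taken one after the other, each time dividing by
a positive weight. -/
theorem J_concave {κ κ' : Fin n → ℝ} (hκ : ∀ i, 0 ≤ κ i) (hκ' : ∀ i, 0 ≤ κ' i) {a b : ℝ}
    (ha : 0 ≤ a) (hb : 0 ≤ b) (hab : a + b = 1) :
    a * M.J κ + b * M.J κ' ≤ M.J (a • κ + b • κ') := by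
  rcases ha.eq_or_lt with rfl | ha'
  · obtain rfl : b = 1 := by linarith
    simp
  rcases hb.eq_or_lt with rfl | hb'
  · obtain rfl : a = 1 := by linarith
    simp
  have h1 : ∀ ψ, M.Feasible κ' ψ → M.J κ ≤ (M.J (a • κ + b • κ') - b * M.value ψ) / a := by
    intro ψ hψ
    refine M.J_le hκ fun φ hφ => ?_
    obtain ⟨h, hv⟩ := hφ.combine hψ ha hb hab
    have := h.value_le_J
    rw [le_div_iff₀ ha']
    linarith
  have h2 : M.J κ' ≤ (M.J (a • κ + b • κ') - a * M.J κ) / b := by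
    refine M.J_le hκ' fun ψ hψ => ?_
    have := h1 ψ hψ
    rw [le_div_iff₀ ha'] at this
    rw [le_div_iff₀ hb']
    linarith
  rw [le_div_iff₀ hb'] at h2
  linarith

theorem J_mono {κ κ' : Fin n → ℝ} (hκ : ∀ i, 0 ≤ κ i) (h : ∀ i, κ i ≤ κ' i) :
    M.J κ ≤ M.J κ' :=
  M.J_le hκ fun _ hφ =>
    Feasible.value_le_J ⟨hφ.1, hφ.2.1, fun i => (hφ.2.2 i).trans (h i)⟩

/-- If no budget rate drops by more than `δ`, then the value of the fluid program drops by at most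
`δ / m`, where `m` is a lower bound of the original budget rates. -/
theorem J_sub_le {κ κ' : Fin n → ℝ} {m δ : ℝ} (hm : 0 < m) (hκ : ∀ i, m ≤ κ i)
    (hκ' : ∀ i, 0 ≤ κ' i) (hδ : 0 ≤ δ) (h : ∀ i, κ i - δ ≤ κ' i) :
    M.J κ - M.J κ' ≤ δ / m := by
  have h0 : ∀ i, 0 ≤ κ i := fun i => hm.le.trans (hκ i)
  have hJ := M.J_mem h0
  have hJ' := M.J_mem hκ'
  rcases le_total m δ with hle | hle
  · have : 1 ≤ δ / m := (one_le_div hm).2 hle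
    linarith [hJ.2, hJ'.1]
  have hs : δ / m ≤ 1 := (div_le_one hm).2 hle
  have hs0 : 0 ≤ δ / m := by positivity
  -- Shrinking `κ` by the factor `1 - δ / m` mixes it with the zero budget and loses at most the
  -- fraction `δ / m` of the value; each entry drops by at least `δ`, so the result lies below `κ'`.
  have h1 := M.J_concave h0 (κ' := 0) (fun _ => le_rfl) (sub_nonneg.2 hs) hs0 (by ring)
  have h2 : M.J ((1 - δ / m) • κ + (δ / m) • (0 : Fin n → ℝ)) ≤ M.J κ' := by
    refine M.J_mono (fun i => ?_) fun i => ?_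
    · simpa using mul_nonneg (sub_nonneg.2 hs) (h0 i)
    · have : δ ≤ δ / m * κ i := by
        rw [div_mul_eq_mul_div, le_div_iff₀ hm]
        exact mul_le_mul_of_nonneg_left (hκ i) hδ
      have h3 := h i
      simp only [smul_zero, add_zero, Pi.smul_apply, smul_eq_mul]
      linarith
  have h3 := (M.J_mem (κ := (0 : Fin n → ℝ)) fun _ => le_rfl).1
  nlinarith [mul_nonneg hs0 h3, mul_le_mul_of_nonneg_left hJ.2 hs0]

open Classical in
-- A concave function on an open subset of a finite-dimensional space is continuous there. The
-- positive orthant suffices, since the budget rates are positive while the algorithm runs.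
theorem measurable_J_piecewise :
    Measurable ({κ : Fin n → ℝ | ∀ i, 0 < κ i}.piecewise M.J fun _ => 0) := by
  have ho : IsOpen {κ : Fin n → ℝ | ∀ i, 0 < κ i} := by
    simp only [Set.ofPred_forall]
    exact isOpen_iInter_of_finite fun i => isOpen_lt continuous_const (continuous_apply i)
  have hc : ConcaveOn ℝ {κ : Fin n → ℝ | ∀ i, 0 < κ i} M.J := by
    refine ⟨?_, fun κ hκ κ' hκ' a b ha hb hab =>
      M.J_concave (fun i => (hκ i).le) (fun i => (hκ' i).le) ha hb hab⟩
    intro κ hκ κ' hκ' a b ha hb hab i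
    exact (convex_Ioi (0 : ℝ)) (hκ i) (hκ' i) ha hb hab
  exact (hc.continuousOn ho).measurable_piecewise continuousOn_const ho.measurableSet

/-- The expectation of a quantity that vanishes under the null action, when the active action is
taken with probability `φ θ`. -/
theorem integral_drawLaw {φ : Θ → ℝ} (hφ : Measurable φ) (hφ1 : ∀ θ, φ θ ∈ Set.Icc (0 : ℝ) 1)
    {q : Θ → Bool → Γ → ℝ} (hq : Measurable fun p : Θ × Γ => q p.1 true p.2)
    (hq1 : ∀ θ γ, q θ true γ ∈ Set.Icc (0 : ℝ) 1) (hq0 : ∀ θ γ, q θ false γ = 0) :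
    ∫ d : Draw Θ Γ, q d.1 (decide ((d.2.2 : ℝ) < φ d.1)) d.2.1 ∂M.drawLaw
      = ∫ θ, φ θ * ∫ γ, q θ true γ ∂M.V ∂M.U := by
  have he : ∀ d : Draw Θ Γ, q d.1 (decide ((d.2.2 : ℝ) < φ d.1)) d.2.1
      = if (d.2.2 : ℝ) < φ d.1 then q d.1 true d.2.1 else 0 := by
    intro d
    by_cases h : (d.2.2 : ℝ) < φ d.1 <;> simp [h, hq0]
  simp_rw [he]
  have hm : Measurable fun d : Draw Θ Γ =>
      if (d.2.2 : ℝ) < φ d.1 then q d.1 true d.2.1 else 0 := by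
    refine Measurable.ite (measurableSet_lt (by fun_prop) (by fun_prop)) ?_ measurable_const
    exact hq.comp (measurable_fst.prodMk measurable_snd.fst)
  have hb : ∀ d : Draw Θ Γ, (if (d.2.2 : ℝ) < φ d.1 then q d.1 true d.2.1 else 0)
      ∈ Set.Icc (0 : ℝ) 1 := by
    intro d
    split_ifs
    exacts [hq1 _ _, ⟨le_rfl, zero_le_one⟩]
  rw [drawLaw, integral_prod _ (integrable_of_mem_Icc hm hb)]
  congr 1 with θ
  have hi : Integrable (fun p : Γ × unitInterval => if (p.2 : ℝ) < φ θ then q θ true p.1 else 0)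
      (M.V.prod volume) :=
    integrable_of_mem_Icc (hm.comp measurable_prodMk_left) fun p => hb (θ, p)
  refine (integral_prod _ hi).trans ?_
  rw [← integral_const_mul]
  congr 1 with γ
  have hset : {u : unitInterval | (u : ℝ) < φ θ} = Set.Iio ⟨φ θ, hφ1 θ⟩ := by
    ext u
    exact Iff.rfl
  have : (fun u : unitInterval => if (u : ℝ) < φ θ then q θ true γ else 0)
      = Set.indicator {u : unitInterval | (u : ℝ) < φ θ} fun _ => q θ true γ := by
    ext u
    simp [Set.indicator_apply]
  simp only [this]
  rw [integral_indicator_const _ (by rw [hset]; exact measurableSet_Iio), hset, measureReal_def,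
    unitInterval.volume_Iio, ENNReal.toReal_ofReal (hφ1 θ).1, smul_eq_mul]

end Environment

/-! ### The run of the algorithm: adaptedness, stopping, measurability. -/

theorem Feedback.measurable_reveal (fb : Feedback) :
    Measurable fun p : Bool × Γ => fb.reveal p.1 p.2 := by
  refine measurable_from_prod_countable_right fun a => ?_
  cases fb <;> cases a <;> simp only [Feedback.reveal]
  · exact measurable_inl
  · exact measurable_inl
  · exact measurable_const
  · exact measurable_inl

namespace Resolver

variable {M : Environment n Θ Γ} (A : Resolver M) (fb : Feedback) (ρ : Fin n → ℝ) (T : ℕ)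

theorem run_succ (ω : ℕ → Draw Θ Γ) (k : ℕ) :
    A.run fb ρ T ω (k + 1) = A.step fb T (A.run fb ρ T ω k) (ω (k + 1)) := rfl

theorem budget_succ (ω : ℕ → Draw Θ Γ) (k : ℕ) (i : Fin n) :
    (A.run fb ρ T ω (k + 1)).budget i = (A.run fb ρ T ω k).budget i
      - M.c (ω (k + 1)).1 (A.nextAction T (A.run fb ρ T ω k) (ω (k + 1))) (ω (k + 1)).2.1 i := rfl

theorem running_succ (ω : ℕ → Draw Θ Γ) (k : ℕ) :
    (A.run fb ρ T ω (k + 1)).running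
      ↔ (A.run fb ρ T ω k).running ∧ ∀ i, 1 ≤ (A.run fb ρ T ω (k + 1)).budget i := Iff.rfl

/-- Adaptedness: the state after `k` rounds does not see later draws. This supplies the independence
hypothesis of `integral_resample`. -/
theorem run_update (ω : ℕ → Draw Θ Γ) {j k : ℕ} (h : k < j) (d : Draw Θ Γ) :
    A.run fb ρ T (Function.update ω j d) k = A.run fb ρ T ω k := by
  induction k with
  | zero => rfl
  | succ k ih => rw [run_succ, run_succ, ih (by omega), Function.update_of_ne (by omega)]

theorem antitone_budget (ω : ℕ → Draw Θ Γ) (i : Fin n) :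
    Antitone fun k => (A.run fb ρ T ω k).budget i := by
  refine antitone_nat_of_succ_le fun k => ?_
  rw [budget_succ]
  linarith [(M.c_mem (ω (k + 1)).1 (A.nextAction T (A.run fb ρ T ω k) (ω (k + 1)))
    (ω (k + 1)).2.1 i).1]

theorem running_iff (ω : ℕ → Draw Θ Γ) (k : ℕ) :
    (A.run fb ρ T ω k).running ↔ ∀ j, 1 ≤ j → j ≤ k → ∀ i, 1 ≤ (A.run fb ρ T ω j).budget i := by
  induction k with
  | zero => exact ⟨fun _ j h1 h2 => by omega, fun _ => trivial⟩
  | succ k ih =>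
    rw [running_succ, ih]
    constructor
    · rintro ⟨h1, h2⟩ j hj hjk
      rcases Nat.lt_or_eq_of_le hjk with h | rfl
      exacts [h1 j hj (by omega), h2]
    · exact fun h => ⟨fun j h1 h2 => h j h1 (by omega), h (k + 1) (by omega) le_rfl⟩

theorem running_of_le (ω : ℕ → Draw Θ Γ) {j k : ℕ} (h : j ≤ k)
    (hk : (A.run fb ρ T ω k).running) : (A.run fb ρ T ω j).running := by
  rw [running_iff] at hk ⊢
  exact fun l h1 h2 => hk l h1 (h2.trans h)

/-- Budgets never increase, so checking the current one suffices. -/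
theorem running_of_one_le_budget (ω : ℕ → Draw Θ Γ) {k : ℕ}
    (h : ∀ i, 1 ≤ (A.run fb ρ T ω k).budget i) : (A.run fb ρ T ω k).running := by
  rw [running_iff]
  exact fun j _ hj i => (h i).trans (A.antitone_budget fb ρ T ω i hj)

theorem le_stopTime_iff (ω : ℕ → Draw Θ Γ) {k : ℕ} (hk : k < T) :
    k + 1 ≤ A.stopTime fb ρ T ω ↔ (A.run fb ρ T ω k).running := by
  have hne : {t : ℕ | 1 ≤ t ∧ (t = T ∨ ∃ i, (A.run fb ρ T ω t).budget i < 1)}.Nonempty :=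
    ⟨T, by omega, Or.inl rfl⟩
  rw [stopTime, le_csInf_iff (OrderBot.bddBelow _) hne, running_iff]
  constructor
  · intro h j h1 h2 i
    by_contra! hlt
    have := h j ⟨h1, Or.inr ⟨i, hlt⟩⟩
    omega
  · rintro h t ⟨h1, rfl | ⟨i, hi⟩⟩
    · exact hk
    · by_contra! hlt
      exact absurd (h t h1 (by omega) i) (not_le.2 hi)

theorem stopTime_le (hT : 1 ≤ T) (ω : ℕ → Draw Θ Γ) : A.stopTime fb ρ T ω ≤ T :=
  Nat.sInf_le ⟨hT, Or.inl rfl⟩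

open Classical in
-- Turns a sum of random length into one of fixed length with indicators, so that expectation and
-- sum can be exchanged.
theorem sum_stopTime (hT : 1 ≤ T) (ω : ℕ → Draw Θ Γ) (f : ℕ → ℝ) :
    ∑ t ∈ Finset.Icc 1 (A.stopTime fb ρ T ω), f t
      = ∑ k ∈ Finset.range T, if (A.run fb ρ T ω k).running then f (k + 1) else 0 := by
  have h : Finset.Icc 1 (A.stopTime fb ρ T ω) = Finset.Ico 1 (A.stopTime fb ρ T ω + 1) := by
    ext t
    simp only [Finset.mem_Icc, Finset.mem_Ico]
    omega
  rw [h, Finset.sum_Ico_eq_sum_range, Nat.add_sub_cancel, ← Finset.sum_filter]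
  have h2 : Finset.range (A.stopTime fb ρ T ω)
      = (Finset.range T).filter fun k => (A.run fb ρ T ω k).running := by
    ext k
    have h3 := A.stopTime_le fb ρ T hT ω
    simp only [Finset.mem_range, Finset.mem_filter]
    constructor
    · intro hk
      exact ⟨by omega, (A.le_stopTime_iff fb ρ T ω (by omega)).1 hk⟩
    · rintro ⟨hk, hr⟩
      exact (A.le_stopTime_iff fb ρ T ω hk).2 hr
  rw [h2]
  exact Finset.sum_congr rfl fun k _ => by rw [add_comm]

theorem nextProb_of_not_running {k : ℕ} {s : RunState n Θ Γ k} (h : ¬ s.running) (θ : Θ) :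
    A.nextProb T s θ = 0 := if_neg h

theorem nextAction_of_not_running {k : ℕ} {s : RunState n Θ Γ k} (h : ¬ s.running)
    (d : Draw Θ Γ) : A.nextAction T s d = false := by
  -- The comparison in `nextAction` is strict, so probability `0` never yields the active action,
  -- even when the uniform number is `0`.
  simp [nextAction, nextProb_of_not_running A T h, d.2.2.2.1]

variable {ρ T}

theorem nextRho_pos (hρ : ∀ i, 0 < ρ i) (ω : ℕ → Draw Θ Γ) {k : ℕ} (hk : k < T)
    (hr : (A.run fb ρ T ω k).running) (i : Fin n) : 0 < nextRho T (A.run fb ρ T ω k) i := by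
  have hT : (0 : ℝ) < (T : ℝ) - k := by
    rw [sub_pos]; exact_mod_cast hk
  refine div_pos ?_ hT
  rcases Nat.eq_zero_or_pos k with rfl | hk0
  · have : (0 : ℝ) < T := by exact_mod_cast hk
    exact mul_pos (hρ i) this
  · exact zero_lt_one.trans_le ((running_iff A fb ρ T ω k).1 hr k hk0 le_rfl i)

theorem nextProb_mem (hρ : ∀ i, 0 < ρ i) (ω : ℕ → Draw Θ Γ) {k : ℕ} (hk : k < T) (θ : Θ) :
    A.nextProb T (A.run fb ρ T ω k) θ ∈ Set.Icc (0 : ℝ) 1 := by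
  by_cases hr : (A.run fb ρ T ω k).running
  · rw [nextProb, if_pos hr]
    exact (A.isSolution k _ _ (A.nextRho_pos fb hρ ω hk hr)).1.2.1 θ
  · rw [A.nextProb_of_not_running T hr]
    exact ⟨le_rfl, zero_le_one⟩

variable (ρ T)

theorem measurable_nextProb_aux {k : ℕ} (hh : Measurable fun ω => (A.run fb ρ T ω k).hist)
    (hb : Measurable fun ω => (A.run fb ρ T ω k).budget)
    (hr : MeasurableSet {ω | (A.run fb ρ T ω k).running}) :
    Measurable fun p : (ℕ → Draw Θ Γ) × Θ => A.nextProb T (A.run fb ρ T p.1 k) p.2 := by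
  unfold nextProb
  refine Measurable.ite (measurable_fst hr) ?_ measurable_const
  refine (A.measurable_sol k).comp (Measurable.prodMk ?_ (Measurable.prodMk ?_ measurable_snd))
  · refine measurable_pi_iff.2 fun i => ?_
    exact (((measurable_pi_apply i).comp hb).comp measurable_fst).div_const _
  · exact hh.comp measurable_fst

theorem measurable_nextAction_of {k : ℕ}
    (h : Measurable fun p : (ℕ → Draw Θ Γ) × Θ => A.nextProb T (A.run fb ρ T p.1 k) p.2) :
    Measurable fun p : (ℕ → Draw Θ Γ) × Draw Θ Γ =>
      A.nextAction T (A.run fb ρ T p.1 k) p.2 := by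
  refine measurable_to_bool ?_
  have : (fun p : (ℕ → Draw Θ Γ) × Draw Θ Γ => A.nextAction T (A.run fb ρ T p.1 k) p.2) ⁻¹' {true}
      = {p | (p.2.2.2 : ℝ) < A.nextProb T (A.run fb ρ T p.1 k) p.2.1} := by
    ext p
    simp [nextAction]
  rw [this]
  exact measurableSet_lt (by fun_prop) (h.comp (measurable_fst.prodMk measurable_snd.fst))

theorem measurable_of_action {β : Type*} [MeasurableSpace β] {q : Θ → Bool → Γ → β}
    (hq : ∀ a, Measurable fun p : Θ × Γ => q p.1 a p.2) {α : Type*} [MeasurableSpace α]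
    {a : α → Bool} (ha : Measurable a) {d : α → Draw Θ Γ} (hd : Measurable d) :
    Measurable fun x => q (d x).1 (a x) (d x).2.1 := by
  have h : Measurable fun p : Bool × (Θ × Γ) => q p.2.1 p.1 p.2.2 :=
    measurable_from_prod_countable_right hq
  exact h.comp (ha.prodMk (hd.fst.prodMk hd.snd.fst))

theorem measurable_run (k : ℕ) : (Measurable fun ω => (A.run fb ρ T ω k).hist) ∧
    (Measurable fun ω => (A.run fb ρ T ω k).budget) ∧
    MeasurableSet {ω | (A.run fb ρ T ω k).running} := by
  induction k with
  | zero => exact ⟨measurable_const, measurable_const, MeasurableSet.univ⟩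
  | succ k ih =>
    obtain ⟨hh, hb, hr⟩ := ih
    have ha : Measurable fun ω : ℕ → Draw Θ Γ =>
        A.nextAction T (A.run fb ρ T ω k) (ω (k + 1)) :=
      (A.measurable_nextAction_of fb ρ T (A.measurable_nextProb_aux fb ρ T hh hb hr)).comp
        (measurable_id.prodMk (measurable_pi_apply (k + 1)))
    have hd : Measurable fun ω : ℕ → Draw Θ Γ => ω (k + 1) := measurable_pi_apply (k + 1)
    have hb' : Measurable fun ω => (A.run fb ρ T ω (k + 1)).budget := by
      refine measurable_pi_iff.2 fun i => ?_
      exact ((measurable_pi_apply i).comp hb).sub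
        (measurable_of_action (q := fun θ a γ => M.c θ a γ i) (fun a => M.measurable_c a i) ha hd)
    refine ⟨measurable_pi_iff.2 fun l => ?_, hb', ?_⟩
    · induction l using Fin.lastCases with
      | last =>
        have : (fun ω => (A.run fb ρ T ω (k + 1)).hist (Fin.last k)) = fun ω =>
            ((ω (k + 1)).1, A.nextAction T (A.run fb ρ T ω k) (ω (k + 1)),
              fb.reveal (A.nextAction T (A.run fb ρ T ω k) (ω (k + 1))) (ω (k + 1)).2.1) := by
          ext1 ω
          simp [run_succ, step]
        rw [this]
        exact hd.fst.prodMk (ha.prodMk (fb.measurable_reveal.comp (ha.prodMk hd.snd.fst)))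
      | cast l =>
        have : (fun ω => (A.run fb ρ T ω (k + 1)).hist l.castSucc)
            = fun ω => (A.run fb ρ T ω k).hist l := by
          ext1 ω
          simp [run_succ, step]
        rw [this]
        exact (measurable_pi_apply l).comp hh
    · have : {ω | (A.run fb ρ T ω (k + 1)).running} = {ω | (A.run fb ρ T ω k).running}
          ∩ ⋂ i, {ω | 1 ≤ (A.run fb ρ T ω (k + 1)).budget i} := by
        ext ω
        simp [running_succ]
      rw [this]
      exact hr.inter (MeasurableSet.iInter fun i =>
        measurableSet_le measurable_const ((measurable_pi_apply i).comp hb'))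

theorem measurableSet_running (k : ℕ) : MeasurableSet {ω | (A.run fb ρ T ω k).running} :=
  (A.measurable_run fb ρ T k).2.2

theorem measurable_nextRho (k : ℕ) : Measurable fun ω => nextRho T (A.run fb ρ T ω k) :=
  measurable_pi_iff.2 fun i =>
    ((measurable_pi_apply i).comp (A.measurable_run fb ρ T k).2.1).div_const _

theorem measurable_nextProb (k : ℕ) :
    Measurable fun p : (ℕ → Draw Θ Γ) × Θ => A.nextProb T (A.run fb ρ T p.1 k) p.2 :=
  A.measurable_nextProb_aux fb ρ T (A.measurable_run fb ρ T k).1 (A.measurable_run fb ρ T k).2.1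
    (A.measurable_run fb ρ T k).2.2

theorem measurable_nextAction (k : ℕ) :
    Measurable fun p : (ℕ → Draw Θ Γ) × Draw Θ Γ => A.nextAction T (A.run fb ρ T p.1 k) p.2 :=
  A.measurable_nextAction_of fb ρ T (A.measurable_nextProb fb ρ T k)

/-! ### Conditional means, consumption noise and the recursion for the budget rate. -/

/-- Expectation, given the state after `k` rounds, of `f` under the active action in the next
round. -/
noncomputable def nextMean (f : Θ → ℝ) (k : ℕ) (ω : ℕ → Draw Θ Γ) : ℝ :=
  ∫ θ, A.nextProb T (A.run fb ρ T ω k) θ * f θ ∂M.U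

theorem measurable_nextMean {f : Θ → ℝ} (hf : Measurable f) (k : ℕ) :
    Measurable (A.nextMean fb ρ T f k) :=
  (((A.measurable_nextProb fb ρ T k).mul
    (hf.comp measurable_snd)).stronglyMeasurable.integral_prod_right).measurable

variable {ρ T}

theorem nextMean_mem (hρ : ∀ i, 0 < ρ i) {f : Θ → ℝ} (hf : Measurable f)
    (hf1 : ∀ θ, f θ ∈ Set.Icc (0 : ℝ) 1) {k : ℕ} (hk : k < T) (ω : ℕ → Draw Θ Γ) :
    A.nextMean fb ρ T f k ω ∈ Set.Icc (0 : ℝ) 1 :=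
  integral_mem_unit (((A.measurable_nextProb fb ρ T k).comp measurable_prodMk_left).mul hf)
    fun θ => mul_mem_unit (A.nextProb_mem fb hρ ω hk θ) (hf1 θ)

theorem integral_nextAction (hρ : ∀ i, 0 < ρ i) {q : Θ → Bool → Γ → ℝ}
    (hq : ∀ a, Measurable fun p : Θ × Γ => q p.1 a p.2)
    (hq1 : ∀ θ a γ, q θ a γ ∈ Set.Icc (0 : ℝ) 1) (hq0 : ∀ θ γ, q θ false γ = 0)
    {k : ℕ} (hk : k < T) (ω : ℕ → Draw Θ Γ) :
    ∫ d : Draw Θ Γ, q d.1 (A.nextAction T (A.run fb ρ T ω k) d) d.2.1 ∂M.drawLaw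
      = A.nextMean fb ρ T (fun θ => ∫ γ, q θ true γ ∂M.V) k ω :=
  M.integral_drawLaw ((A.measurable_nextProb fb ρ T k).comp measurable_prodMk_left)
    (A.nextProb_mem fb hρ ω hk) (hq true) (fun θ γ => hq1 θ true γ) hq0

/-- Deviation of the consumption in round `k + 1` from its conditional expectation. -/
noncomputable def noise (A : Resolver M) (fb : Feedback) (ρ : Fin n → ℝ) (T : ℕ) (i : Fin n)
    (k : ℕ) (p : (ℕ → Draw Θ Γ) × Draw Θ Γ) : ℝ :=
  A.nextMean fb ρ T (fun θ => M.C θ i) k p.1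
    - M.c p.2.1 (A.nextAction T (A.run fb ρ T p.1 k) p.2) p.2.2.1 i

theorem measurable_noise (i : Fin n) (k : ℕ) : Measurable (A.noise fb ρ T i k) :=
  ((A.measurable_nextMean fb ρ T (M.measurable_C i) k).comp measurable_fst).sub
    (measurable_of_action (q := fun θ a γ => M.c θ a γ i) (fun a => M.measurable_c a i)
      (A.measurable_nextAction fb ρ T k) measurable_snd)

theorem noise_mem (i : Fin n) (k : ℕ) (p : (ℕ → Draw Θ Γ) × Draw Θ Γ) :
    A.noise fb ρ T i k p ∈ Set.Icc (A.nextMean fb ρ T (fun θ => M.C θ i) k p.1 - 1)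
      (A.nextMean fb ρ T (fun θ => M.C θ i) k p.1) := by
  have := M.c_mem p.2.1 (A.nextAction T (A.run fb ρ T p.1 k) p.2) p.2.2.1 i
  constructor <;> simp only [noise] <;> linarith [this.1, this.2]

theorem noise_update (i : Fin n) {j k : ℕ} (h : k < j) (ω : ℕ → Draw Θ Γ) (d d' : Draw Θ Γ) :
    A.noise fb ρ T i k (Function.update ω j d', d) = A.noise fb ρ T i k (ω, d) := by
  simp only [noise, nextMean, run_update A fb ρ T ω h d']

theorem integral_noise (hρ : ∀ i, 0 < ρ i) (i : Fin n) {k : ℕ} (hk : k < T)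
    (ω : ℕ → Draw Θ Γ) : ∫ d, A.noise fb ρ T i k (ω, d) ∂M.drawLaw = 0 := by
  have hm := measurable_of_action (q := fun θ a γ => M.c θ a γ i) (fun a => M.measurable_c a i)
    ((A.measurable_nextAction fb ρ T k).comp (measurable_prodMk_left (x := ω)))
    (measurable_id (α := Draw Θ Γ))
  have hi := integrable_of_mem_Icc (μ := M.drawLaw) hm fun d => M.c_mem _ _ _ i
  simp only [noise]
  refine (integral_sub (integrable_const _) hi).trans ?_
  have h := A.integral_nextAction fb hρ (q := fun θ a γ => M.c θ a γ i)
    (fun a => M.measurable_c a i) (fun θ a γ => M.c_mem θ a γ i) (fun θ γ => M.c_null θ γ i) hk ω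
  simp only [integral_const, probReal_univ, one_smul]
  exact sub_eq_zero.2 h.symm

/-- Evolution of the average remaining budget. -/
theorem nextRho_eq (i : Fin n) (ω : ℕ → Draw Θ Γ) {k : ℕ} (hk : k < T) :
    nextRho T (A.run fb ρ T ω k) i = ρ i
      + ∑ j ∈ Finset.range k, A.consumptionError fb ρ T ω (j + 1) i
      + ∑ j ∈ Finset.range k, A.noise fb ρ T i j (ω, ω (j + 1)) / ((T : ℝ) - (j + 1)) := by
  induction k with
  | zero =>
    have : (T : ℝ) ≠ 0 := by exact_mod_cast (by omega : T ≠ 0)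
    simp [nextRho, run, this]
  | succ k ih =>
    have h1 : (0 : ℝ) < (T : ℝ) - (k + 1) := by
      rw [sub_pos]; exact_mod_cast hk
    have h2 : (0 : ℝ) < (T : ℝ) - k := by linarith
    have ih := ih (by omega)
    rw [Finset.sum_range_succ, Finset.sum_range_succ]
    have h3 : A.consumptionError fb ρ T ω (k + 1) i
        = (nextRho T (A.run fb ρ T ω k) i - A.nextMean fb ρ T (fun θ => M.C θ i) k ω)
          / ((T : ℝ) - (k + 1)) := by
      simp only [consumptionError, rho, prob, nextMean, nextRho]
      push_cast
      congr 3
      ring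
    have h4 : nextRho T (A.run fb ρ T ω (k + 1)) i
        = nextRho T (A.run fb ρ T ω k) i
          + (nextRho T (A.run fb ρ T ω k) i
            - M.c (ω (k + 1)).1 (A.nextAction T (A.run fb ρ T ω k) (ω (k + 1))) (ω (k + 1)).2.1 i)
            / ((T : ℝ) - (k + 1)) := by
      simp only [nextRho, budget_succ]
      push_cast
      field_simp
      ring
    have h5 : A.noise fb ρ T i k (ω, ω (k + 1)) = A.nextMean fb ρ T (fun θ => M.C θ i) k ω
        - M.c (ω (k + 1)).1 (A.nextAction T (A.run fb ρ T ω k) (ω (k + 1)))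
          (ω (k + 1)).2.1 i := rfl
    rw [h4, h3, h5, sub_div, sub_div, sub_div]
    linarith

end Resolver

/-! ### Deterministic sums of weights and radii. -/

theorem sum_Icc_one_eq_sum_range (f : ℕ → ℝ) (k : ℕ) :
    ∑ t ∈ Finset.Icc 1 k, f t = ∑ j ∈ Finset.range k, f (j + 1) := by
  induction k with
  | zero => simp
  | succ k ih => rw [Finset.sum_Icc_succ_top (by omega), ih, Finset.sum_range_succ]

/-- A bound for the variance proxy of the accumulated noise. -/
theorem sum_inv_sq_le (T k : ℕ) (hk : k + 1 < T) :
    ∑ j ∈ Finset.range k, (1 / ((T : ℝ) - (j + 1))) ^ 2 ≤ 1 / ((T : ℝ) - (k + 1)) := by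
  induction k with
  | zero =>
    have : (1 : ℝ) < T := by exact_mod_cast hk
    simpa using this.le
  | succ k ih =>
    rw [Finset.sum_range_succ]
    have ih := ih (by omega)
    have h1 : (k : ℝ) + 1 + 1 < T := by exact_mod_cast hk
    -- Telescoping: with `m` rounds left, `1 / (m + 1)² ≤ 1 / m - 1 / (m + 1)`.
    have h2 : 1 / ((T : ℝ) - (k + 1)) + (1 / ((T : ℝ) - (k + 1))) ^ 2
        ≤ 1 / ((T : ℝ) - (k + 1 + 1)) := by
      obtain ⟨m, hm⟩ : ∃ m : ℝ, m = (T : ℝ) - (k + 1 + 1) := ⟨_, rfl⟩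
      have hm0 : 0 < m := by linarith
      have h3 : (T : ℝ) - (k + 1) = m + 1 := by linarith
      rw [h3, ← hm, div_add' _ _ _ (by positivity), div_le_div_iff₀ (by positivity) hm0]
      have : 1 / (m + 1) ^ 2 * (m + 1) = 1 / (m + 1) := by field_simp
      rw [one_div_pow, this]
      have h4 : 1 / (m + 1) * m ≤ 1 := by
        rw [div_mul_eq_mul_div, div_le_one (by positivity)]
        linarith
      linarith
    push_cast
    linarith

theorem sum_one_div_sqrt_le (m : ℕ) :
    ∑ s ∈ Finset.range m, 1 / √((s : ℝ) + 1) ≤ 2 * √m := by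
  induction m with
  | zero => simp
  | succ m ih =>
    rw [Finset.sum_range_succ]
    have h1 : (0 : ℝ) < √((m : ℝ) + 1) := Real.sqrt_pos.2 (by positivity)
    have h2 : √(m : ℝ) ^ 2 = m := Real.sq_sqrt (by positivity)
    have h3 : √((m : ℝ) + 1) ^ 2 = m + 1 := Real.sq_sqrt (by positivity)
    have h4 : 1 / √((m : ℝ) + 1) ≤ 2 * √((m : ℝ) + 1) - 2 * √m := by
      rw [div_le_iff₀ h1]
      nlinarith [sq_nonneg (√((m : ℝ) + 1) - √m)]
    push_cast
    linarith

/-- Deviation radius of the average remaining budget in round `k + 1`. -/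
noncomputable def radius (T k : ℕ) : ℝ := √(2 * Real.log T / ((T : ℝ) - (k + 1)))

theorem sum_radius_le (T : ℕ) (hT : 1 ≤ T) :
    ∑ k ∈ Finset.range (T - 1), radius T k ≤ 2 * √(2 * T * Real.log T) := by
  have hlog : 0 ≤ Real.log T := Real.log_nonneg (by exact_mod_cast hT)
  have h1 : ∀ s ∈ Finset.range (T - 1), radius T (T - 1 - 1 - s)
      = √(2 * Real.log T) * (1 / √((s : ℝ) + 1)) := by
    intro s hs
    rw [Finset.mem_range] at hs
    have h : ((T - 1 - 1 - s : ℕ) : ℝ) = T - 1 - 1 - s := by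
      have : T = (T - 1 - 1 - s) + (1 + 1 + s) := by omega
      have h' : (T : ℝ) = ((T - 1 - 1 - s : ℕ) : ℝ) + (1 + 1 + s) := by exact_mod_cast this
      linarith
    rw [radius, h, Real.sqrt_div (by positivity), div_eq_mul_one_div]
    congr 3
    ring
  rw [← Finset.sum_range_reflect, Finset.sum_congr rfl h1, ← Finset.mul_sum]
  have h2 : √((T - 1 : ℕ) : ℝ) ≤ √T := Real.sqrt_le_sqrt (by exact_mod_cast Nat.sub_le T 1)
  have h3 : √(2 * T * Real.log T) = √(2 * Real.log T) * √T := by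
    rw [← Real.sqrt_mul (by positivity)]
    congr 1
    ring
  rw [h3]
  have h4 := (sum_one_div_sqrt_le (T - 1)).trans (mul_le_mul_of_nonneg_left h2 zero_le_two)
  calc _ ≤ √(2 * Real.log T) * (2 * √T) := mul_le_mul_of_nonneg_left h4 (Real.sqrt_nonneg _)
    _ = _ := by ring

/-! ### Concentration of the accumulated noise and of the budget rate. -/

namespace Resolver

variable {M : Environment n Θ Γ} (A : Resolver M) (fb : Feedback) {ρ : Fin n → ℝ} {T : ℕ}

/-- Weighted sum of the consumption noise of the first `k` rounds. -/
noncomputable def noiseSum (A : Resolver M) (fb : Feedback) (ρ : Fin n → ℝ) (T : ℕ) (i : Fin n)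
    (k : ℕ) (ω : ℕ → Draw Θ Γ) : ℝ :=
  ∑ j ∈ Finset.range k, A.noise fb ρ T i j (ω, ω (j + 1)) / ((T : ℝ) - (j + 1))

theorem measurable_noiseSum (i : Fin n) (k : ℕ) : Measurable (A.noiseSum fb ρ T i k) :=
  Finset.measurable_fun_sum _ fun j _ => ((A.measurable_noise fb i j).comp
    (measurable_id.prodMk (measurable_pi_apply (j + 1)))).div_const _

theorem noiseSum_update (i : Fin n) {j k : ℕ} (h : k < j) (ω : ℕ → Draw Θ Γ) (d : Draw Θ Γ) :
    A.noiseSum fb ρ T i k (Function.update ω j d) = A.noiseSum fb ρ T i k ω := by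
  refine Finset.sum_congr rfl fun l hl => ?_
  rw [Finset.mem_range] at hl
  rw [noise_update A fb i (by omega), Function.update_of_ne (by omega)]

theorem abs_noise_le (hρ : ∀ i, 0 < ρ i) (i : Fin n) {k : ℕ} (hk : k < T)
    (p : (ℕ → Draw Θ Γ) × Draw Θ Γ) : |A.noise fb ρ T i k p| ≤ 1 := by
  have h1 := A.noise_mem (ρ := ρ) (T := T) fb i k p
  have h2 := A.nextMean_mem fb hρ (M.measurable_C i) (fun θ => M.C_mem θ i) hk p.1
  rw [abs_le]
  constructor <;> linarith [h1.1, h1.2, h2.1, h2.2]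

theorem abs_noiseSum_le (hρ : ∀ i, 0 < ρ i) (i : Fin n) {k : ℕ} (hk : k < T)
    (ω : ℕ → Draw Θ Γ) :
    |A.noiseSum fb ρ T i k ω| ≤ ∑ j ∈ Finset.range k, |1 / ((T : ℝ) - (j + 1))| := by
  refine (Finset.abs_sum_le_sum_abs _ _).trans (Finset.sum_le_sum fun j hj => ?_)
  rw [Finset.mem_range] at hj
  rw [abs_div, abs_div, abs_one]
  exact div_le_div_of_nonneg_right (A.abs_noise_le fb hρ i (by omega) _) (abs_nonneg _)

theorem mgf_noise_le (hρ : ∀ i, 0 < ρ i) (i : Fin n) {k : ℕ} (hk : k < T) (ω : ℕ → Draw Θ Γ)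
    (l : ℝ) : ∫ d, Real.exp (l * A.noise fb ρ T i k (ω, d)) ∂M.drawLaw ≤ Real.exp (l ^ 2 / 2) := by
  have h := (hasSubgaussianMGF_of_mem_Icc_of_integral_eq_zero (μ := M.drawLaw)
    (X := fun d => A.noise fb ρ T i k (ω, d))
    (a := A.nextMean fb ρ T (fun θ => M.C θ i) k ω - 1)
    (b := A.nextMean fb ρ T (fun θ => M.C θ i) k ω)
    ((A.measurable_noise fb i k).comp measurable_prodMk_left).aemeasurable
    (.of_forall fun d => A.noise_mem fb i k (ω, d)) (A.integral_noise fb hρ i hk ω)).mgf_le l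
  -- Hoeffding's lemma gives `l² / 8` in the exponent; the weaker `l² / 2` already matches the
  -- stated radius.
  refine (show _ = mgf _ _ _ from rfl).trans_le (h.trans (Real.exp_le_exp.2 ?_))
  simp only [sub_sub_cancel, nnnorm_one, NNReal.coe_pow, NNReal.coe_div, NNReal.coe_one,
    NNReal.coe_ofNat]
  nlinarith [sq_nonneg l]

/-- Azuma–Hoeffding by induction: resample the draw of round `k + 1`, integrate out its noise with
`mgf_noise_le`, and multiply by the bound for the earlier rounds. -/
theorem mgf_noiseSum_le (hρ : ∀ i, 0 < ρ i) (i : Fin n) (l : ℝ) {k : ℕ} (hk : k < T) :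
    ∫ ω, Real.exp (l * A.noiseSum fb ρ T i k ω) ∂M.law
      ≤ Real.exp (l ^ 2 / 2 * ∑ j ∈ Finset.range k, (1 / ((T : ℝ) - (j + 1))) ^ 2) := by
  induction k with
  | zero => simp [noiseSum]
  | succ k ih =>
    have ih := ih (by omega)
    obtain ⟨w, hw⟩ : ∃ w : ℝ, w = 1 / ((T : ℝ) - (k + 1)) := ⟨_, rfl⟩
    let f : (ℕ → Draw Θ Γ) × Draw Θ Γ → ℝ := fun p =>
      Real.exp (l * A.noiseSum fb ρ T i k p.1) * Real.exp (l * w * A.noise fb ρ T i k p)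
    have hf : Measurable f :=
      ((((A.measurable_noiseSum fb i k).comp measurable_fst).const_mul l).exp).mul
        (((A.measurable_noise fb i k).const_mul (l * w)).exp)
    have hfe : ∀ ω, Real.exp (l * A.noiseSum fb ρ T i (k + 1) ω) = f (ω, ω (k + 1)) := by
      intro ω
      simp only [f, ← Real.exp_add]
      rw [noiseSum, Finset.sum_range_succ, ← noiseSum, hw]
      congr 1
      ring
    obtain ⟨K, hK⟩ : ∃ K : ℝ, ∀ ω, l * A.noiseSum fb ρ T i k ω ≤ K :=
      ⟨|l| * ∑ j ∈ Finset.range k, |1 / ((T : ℝ) - (j + 1))|, fun ω =>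
        (le_abs_self _).trans (by
          rw [abs_mul]
          exact mul_le_mul_of_nonneg_left (A.abs_noiseSum_le fb hρ i (by omega) ω)
            (abs_nonneg l))⟩
    have hK2 : ∀ p, l * w * A.noise fb ρ T i k p ≤ |l * w| := fun p =>
      (le_abs_self _).trans (by
        rw [abs_mul]
        exact mul_le_of_le_one_right (abs_nonneg _) (A.abs_noise_le fb hρ i (by omega) p))
    have hb : ∀ p, |f p| ≤ Real.exp K * Real.exp |l * w| := by
      intro p
      rw [abs_of_nonneg (by positivity)]
      exact mul_le_mul (Real.exp_le_exp.2 (hK p.1)) (Real.exp_le_exp.2 (hK2 p))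
        (by positivity) (by positivity)
    simp_rw [hfe]
    rw [Environment.law_eq, integral_resample M.drawLaw hf hb (k + 1) fun ω d d' => by
      simp only [f, noiseSum_update A fb i (Nat.lt_succ_self k),
        noise_update A fb i (Nat.lt_succ_self k)], ← Environment.law_eq]
    have hexp : Measurable fun ω => Real.exp (l * A.noiseSum fb ρ T i k ω) :=
      ((A.measurable_noiseSum fb i k).const_mul l).exp
    have hint : Integrable (fun ω => Real.exp (l * A.noiseSum fb ρ T i k ω)) M.law :=
      integrable_of_mem_Icc hexp (a := 0) (b := Real.exp K)
        fun ω => ⟨by positivity, Real.exp_le_exp.2 (hK ω)⟩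
    calc ∫ ω, ∫ d, f (ω, d) ∂M.drawLaw ∂M.law
        ≤ ∫ ω, Real.exp (l * A.noiseSum fb ρ T i k ω) * Real.exp ((l * w) ^ 2 / 2) ∂M.law := by
          refine integral_mono_of_nonneg (.of_forall fun ω => ?_) (hint.mul_const _)
            (.of_forall fun ω => ?_)
          · exact integral_nonneg fun d => by positivity
          · simp only [f]
            rw [integral_const_mul]
            exact mul_le_mul_of_nonneg_left (A.mgf_noise_le fb hρ i (by omega) ω _)
              (by positivity)
      _ ≤ Real.exp (l ^ 2 / 2 * ∑ j ∈ Finset.range k, (1 / ((T : ℝ) - (j + 1))) ^ 2)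
          * Real.exp ((l * w) ^ 2 / 2) := by
          rw [integral_mul_const]
          exact mul_le_mul_of_nonneg_right ih (by positivity)
      _ = _ := by
          rw [← Real.exp_add, Finset.sum_range_succ, ← hw]
          congr 1
          ring

theorem noiseSum_tail (hρ : ∀ i, 0 < ρ i) (i : Fin n) {k : ℕ} (hk : k + 1 < T) :
    M.law.real {ω | A.noiseSum fb ρ T i k ω ≤ -radius T k} ≤ 1 / T := by
  obtain ⟨m, hm⟩ : ∃ m : ℝ, m = (T : ℝ) - (k + 1) := ⟨_, rfl⟩
  have hm0 : 0 < m := by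
    have : (k : ℝ) + 1 < T := by exact_mod_cast hk
    linarith
  have hT : (1 : ℝ) ≤ T := by exact_mod_cast (by omega : 1 ≤ T)
  have hlog : 0 ≤ Real.log T := Real.log_nonneg hT
  obtain ⟨x, hx⟩ : ∃ x : ℝ, x = radius T k := ⟨_, rfl⟩
  have hx0 : 0 ≤ x := hx ▸ Real.sqrt_nonneg _
  have hx2 : x ^ 2 * m = 2 * Real.log T := by
    rw [hx, radius, ← hm, Real.sq_sqrt (by positivity), div_mul_cancel₀ _ hm0.ne']
  -- Chernoff parameter `-(x * m)`: it minimizes `l * x + l² / (2 * m)`, with minimum `-x² * m / 2 =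
  -- -log T`.
  have hl : -(x * m) ≤ 0 := by
    have : 0 ≤ x * m := by positivity
    linarith
  have hmeas : Measurable fun ω => Real.exp (-(x * m) * A.noiseSum fb ρ T i k ω) :=
    ((A.measurable_noiseSum fb i k).const_mul _).exp
  have hint : Integrable (fun ω => Real.exp (-(x * m) * A.noiseSum fb ρ T i k ω)) M.law := by
    refine integrable_of_mem_Icc hmeas (a := 0)
      (b := Real.exp (x * m * ∑ j ∈ Finset.range k, |1 / ((T : ℝ) - (j + 1))|))
      fun ω => ⟨by positivity, Real.exp_le_exp.2 ?_⟩
    have := (abs_le.1 (A.abs_noiseSum_le (T := T) fb hρ i (k := k) (by omega) ω)).1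
    nlinarith
  rw [← hx]
  refine (measure_le_le_exp_mul_mgf (-x) hl hint).trans ?_
  have hmgf := A.mgf_noiseSum_le (T := T) fb hρ i (-(x * m)) (k := k) (by omega)
  have hV := sum_inv_sq_le T k hk
  rw [← hm] at hV
  calc _ ≤ Real.exp (-(-(x * m)) * -x) * Real.exp ((-(x * m)) ^ 2 / 2 * (1 / m)) := by
        refine mul_le_mul_of_nonneg_left (hmgf.trans (Real.exp_le_exp.2 ?_)) (by positivity)
        exact mul_le_mul_of_nonneg_left hV (by positivity)
    _ = Real.exp (-Real.log T) := by
        rw [← Real.exp_add]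
        congr 1
        field_simp
        nlinarith
    _ = 1 / T := by
        rw [Real.exp_neg, Real.exp_log (by linarith), one_div]

/-- With high probability no average remaining budget falls far below its initial value. -/
theorem prob_nextRho_lt (hρ : ∀ i, 0 < ρ i) {err : ℕ → ℝ → ℝ}
    (herr : A.ConsumptionErrorBound fb ρ T err) {k : ℕ} (hk : k + 1 < T) {ε : ℝ} (hε : 0 < ε) :
    M.law.real {ω | ¬ ∀ i, ρ i - (err (k + 1) ε + radius T k) ≤ nextRho T (A.run fb ρ T ω k) i}
      ≤ ε + n / T := by
  have h1 := herr (k + 1) (Finset.mem_Icc.2 ⟨by omega, by omega⟩) ε hε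
  have hsub : {ω | ¬ ∀ i, ρ i - (err (k + 1) ε + radius T k) ≤ nextRho T (A.run fb ρ T ω k) i}
      ⊆ {ω | ⨅ i, ∑ τ ∈ Finset.Icc 1 (k + 1 - 1), A.consumptionError fb ρ T ω τ i
          ≤ -err (k + 1) ε} ∪ ⋃ i : Fin n, {ω | A.noiseSum fb ρ T i k ω ≤ -radius T k} := by
    intro ω hω
    by_contra hc
    simp only [Set.mem_union, Set.mem_ofPred_eq, Set.mem_iUnion, not_or, not_exists, not_le] at hc
    refine hω fun i => ?_
    have h2 := hc.1.trans_le (ciInf_le (Set.finite_range _).bddBelow i)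
    rw [Nat.add_sub_cancel, sum_Icc_one_eq_sum_range] at h2
    have h3 := hc.2 i
    rw [noiseSum] at h3
    rw [A.nextRho_eq fb i ω (by omega : k < T)]
    linarith
  refine (measureReal_mono hsub).trans ((measureReal_union_le _ _).trans (add_le_add h1 ?_))
  refine (measureReal_iUnion_fintype_le _).trans ?_
  refine (Finset.sum_le_sum fun i _ => A.noiseSum_tail fb hρ i hk).trans (le_of_eq ?_)
  simp [div_eq_mul_inv]

end Resolver

/-! ### Loss of fluid value, missed rounds and the regret decomposition. -/

namespace Resolver

variable {M : Environment n Θ Γ} (A : Resolver M) (fb : Feedback) (ρ : Fin n → ℝ) (T : ℕ)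

open Classical in
/-- The fluid value at the average remaining budget of round `k + 1`, and `0` after stopping. -/
noncomputable def runValue (k : ℕ) (ω : ℕ → Draw Θ Γ) : ℝ :=
  if (A.run fb ρ T ω k).running then M.J (nextRho T (A.run fb ρ T ω k)) else 0

open Classical in
/-- Loss of fluid value in round `k + 1`, and `0` after stopping. -/
noncomputable def runLoss (k : ℕ) (ω : ℕ → Draw Θ Γ) : ℝ :=
  if (A.run fb ρ T ω k).running then M.J ρ - M.J (nextRho T (A.run fb ρ T ω k)) else 0

variable {ρ T}

theorem measurable_runValue (hρ : ∀ i, 0 < ρ i) {k : ℕ} (hk : k < T) :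
    Measurable (A.runValue fb ρ T k) := by
  classical
  have h : A.runValue fb ρ T k = fun ω => if (A.run fb ρ T ω k).running then
      {κ : Fin n → ℝ | ∀ i, 0 < κ i}.piecewise M.J (fun _ => 0) (nextRho T (A.run fb ρ T ω k))
      else 0 := by
    ext ω
    unfold runValue
    split_ifs with hr
    · exact (Set.piecewise_eq_of_mem _ _ _
        (show _ ∈ {κ : Fin n → ℝ | ∀ i, 0 < κ i} from A.nextRho_pos fb hρ ω hk hr)).symm
    · rfl
  rw [h]
  refine Measurable.ite (A.measurableSet_running fb ρ T k) ?_ measurable_const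
  exact M.measurable_J_piecewise.comp (A.measurable_nextRho fb ρ T k)

theorem runValue_mem (hρ : ∀ i, 0 < ρ i) {k : ℕ} (hk : k < T) (ω : ℕ → Draw Θ Γ) :
    A.runValue fb ρ T k ω ∈ Set.Icc (0 : ℝ) 1 := by
  unfold runValue
  split_ifs with hr
  · exact M.J_mem fun i => (A.nextRho_pos fb hρ ω hk hr i).le
  · exact ⟨le_rfl, zero_le_one⟩

theorem runLoss_eq (k : ℕ) (ω : ℕ → Draw Θ Γ) : A.runLoss fb ρ T k ω
    = {ω | (A.run fb ρ T ω k).running}.indicator (fun _ => M.J ρ) ω - A.runValue fb ρ T k ω := by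
  by_cases hr : (A.run fb ρ T ω k).running <;> simp [runLoss, runValue, hr]

theorem integrable_runValue (hρ : ∀ i, 0 < ρ i) {k : ℕ} (hk : k < T) :
    Integrable (A.runValue fb ρ T k) M.law :=
  integrable_of_mem_Icc (A.measurable_runValue fb hρ hk) (A.runValue_mem fb hρ hk)

theorem integrable_running_indicator (k : ℕ) (x : ℝ) :
    Integrable ({ω | (A.run fb ρ T ω k).running}.indicator fun _ => x) M.law :=
  (integrable_const x).indicator (A.measurableSet_running fb ρ T k)

theorem integral_runLoss (hρ : ∀ i, 0 < ρ i) {k : ℕ} (hk : k < T) :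
    ∫ ω, A.runLoss fb ρ T k ω ∂M.law
      = M.J ρ * M.law.real {ω | (A.run fb ρ T ω k).running}
        - ∫ ω, A.runValue fb ρ T k ω ∂M.law := by
  simp_rw [runLoss_eq]
  rw [integral_sub (A.integrable_running_indicator fb k _) (A.integrable_runValue fb hρ hk),
    integral_indicator_const _ (A.measurableSet_running fb ρ T k), smul_eq_mul, mul_comm]

theorem runLoss_le_one (hρ : ∀ i, 0 < ρ i) {k : ℕ} (hk : k < T) (ω : ℕ → Draw Θ Γ) :
    A.runLoss fb ρ T k ω ≤ 1 := by
  unfold runLoss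
  split_ifs with hr
  · have h1 := (M.J_mem fun i => (hρ i).le).2
    have h2 := (M.J_mem fun i => (A.nextRho_pos fb hρ ω hk hr i).le).1
    linarith
  · exact zero_le_one

theorem integrable_runLoss (hρ : ∀ i, 0 < ρ i) {k : ℕ} (hk : k < T) :
    Integrable (A.runLoss fb ρ T k) M.law :=
  ((A.integrable_running_indicator fb k _).sub (A.integrable_runValue fb hρ hk)).congr
    (.of_forall fun ω => (A.runLoss_eq fb k ω).symm)

theorem integral_runLoss_le_one (hρ : ∀ i, 0 < ρ i) {k : ℕ} (hk : k < T) :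
    ∫ ω, A.runLoss fb ρ T k ω ∂M.law ≤ 1 := by
  have := integral_mono (A.integrable_runLoss fb hρ hk) (integrable_const (1 : ℝ))
    (A.runLoss_le_one fb hρ hk)
  simpa using this

/-- The expected loss of fluid value in a round before the last one. -/
theorem integral_runLoss_le {m : ℝ} (hm : 0 < m) (hm1 : m ≤ 1) (hρ : ∀ i, m ≤ ρ i)
    {err : ℕ → ℝ → ℝ} (herr : A.ConsumptionErrorBound fb ρ T err) {k : ℕ} (hk : k + 1 < T)
    {ε : ℝ} (hε : 0 < ε) (herr0 : 0 ≤ err (k + 1) ε) :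
    ∫ ω, A.runLoss fb ρ T k ω ∂M.law ≤ (err (k + 1) ε + ε + radius T k + n / T) / m := by
  have hρ0 : ∀ i, 0 < ρ i := fun i => hm.trans_le (hρ i)
  obtain ⟨δ, hδ⟩ : ∃ δ, δ = err (k + 1) ε + radius T k := ⟨_, rfl⟩
  have hδ0 : 0 ≤ δ := hδ ▸ add_nonneg herr0 (Real.sqrt_nonneg _)
  have hprob := A.prob_nextRho_lt fb hρ0 herr hk hε
  rw [← hδ] at hprob
  set S := {ω | ¬ ∀ i, ρ i - δ ≤ nextRho T (A.run fb ρ T ω k) i} with hS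
  have hSm : MeasurableSet S := by
    have : S = (⋂ i, {ω | ρ i - δ ≤ nextRho T (A.run fb ρ T ω k) i})ᶜ := by
      ext ω
      simp [hS]
    rw [this]
    exact (MeasurableSet.iInter fun i => measurableSet_le measurable_const
      ((measurable_pi_apply i).comp (A.measurable_nextRho fb ρ T k))).compl
  -- Off the bad event `S` the stability of `J` applies; on `S` the loss is at most `1`.
  have hle : ∀ ω, A.runLoss fb ρ T k ω ≤ δ / m + S.indicator (fun _ => 1) ω := by
    intro ω
    have hpos : 0 ≤ δ / m := by positivity
    by_cases hω : ω ∈ S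
    · rw [Set.indicator_of_mem hω]
      linarith [A.runLoss_le_one fb hρ0 (by omega : k < T) ω]
    · rw [Set.indicator_of_notMem hω, add_zero]
      unfold runLoss
      split_ifs with hr
      · exact M.J_sub_le hm hρ
          (fun i => (A.nextRho_pos fb hρ0 ω (by omega) hr i).le) hδ0 (not_not.1 hω)
      · exact hpos
  have hi : Integrable (S.indicator fun _ => (1 : ℝ)) M.law := (integrable_const _).indicator hSm
  have h := integral_mono (A.integrable_runLoss fb hρ0 (by omega : k < T))
    ((integrable_const (δ / m)).add hi) hle
  have h' : ∫ ω, A.runLoss fb ρ T k ω ∂M.law ≤ δ / m + M.law.real S := by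
    refine h.trans (le_of_eq ?_)
    simp only [Pi.add_apply]
    rw [integral_add (integrable_const _) hi, integral_indicator_const _ hSm]
    simp
  -- Since `m ≤ 1`, the failure probability can be put under the same factor `1 / m`.
  have h2 : ε + n / T ≤ (ε + n / T) / m := le_div_self (by positivity) hm hm1
  have h3 : (err (k + 1) ε + ε + radius T k + n / T) / m = δ / m + (ε + n / T) / m := by
    rw [← add_div, hδ]
    congr 1
    ring
  linarith

/-- The expected number of rounds missed because of stopping, in terms of a round which is reached
with high probability. -/
theorem sum_not_running_le {m : ℝ} (hρ0 : ∀ i, 0 < ρ i) (hρ : ∀ i, m ≤ ρ i)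
    {err : ℕ → ℝ → ℝ} (herr : A.ConsumptionErrorBound fb ρ T err) {k : ℕ} (hk : k + 1 < T)
    {ε : ℝ} (hε : 0 < ε)
    (h : err (k + 1) ε + radius T k ≤ m - 1 / ((T : ℝ) - (k + 1) + 1)) :
    ∑ j ∈ Finset.range T, (1 - M.law.real {ω | (A.run fb ρ T ω j).running})
      ≤ (T : ℝ) - (1 - ε - n / T) * (k + 1) := by
  have hprob := A.prob_nextRho_lt fb hρ0 herr hk hε
  have hk' : (k : ℝ) + 1 < T := by exact_mod_cast hk
  have hsub : {ω | (A.run fb ρ T ω k).running}ᶜ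
      ⊆ {ω | ¬ ∀ i, ρ i - (err (k + 1) ε + radius T k) ≤ nextRho T (A.run fb ρ T ω k) i} := by
    intro ω hω hc
    refine hω (A.running_of_one_le_budget fb ρ T ω fun i => ?_)
    have h1 := hc i
    -- At the start of round `k + 1` there are `T - k` rounds left, so this says that the budget is
    -- at least `1`.
    have h2 : 1 / ((T : ℝ) - k) ≤ nextRho T (A.run fb ρ T ω k) i := by
      have h3 : (T : ℝ) - (k + 1) + 1 = T - k := by ring
      rw [h3] at h
      linarith [hρ i]
    rw [nextRho, div_le_div_iff_of_pos_right (by linarith)] at h2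
    exact h2
  have hjk : ∀ j ≤ k, 1 - M.law.real {ω | (A.run fb ρ T ω j).running} ≤ ε + n / T := by
    intro j hj
    rw [← probReal_compl_eq_one_sub (A.measurableSet_running fb ρ T j)]
    refine (measureReal_mono fun ω hω => hsub ?_).trans hprob
    exact fun hr => hω (A.running_of_le fb ρ T ω hj hr)
  have hsplit : Finset.range T = Finset.range (k + 1) ∪ Finset.Ico (k + 1) T := by
    rw [Finset.range_eq_Ico, Finset.range_eq_Ico, Finset.Ico_union_Ico_eq_Ico (by omega) hk.le]
  have hdisj : Disjoint (Finset.range (k + 1)) (Finset.Ico (k + 1) T) := by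
    rw [Finset.range_eq_Ico]
    exact Finset.Ico_disjoint_Ico_consecutive 0 (k + 1) T
  rw [hsplit, Finset.sum_union hdisj]
  have h1 : ∑ j ∈ Finset.range (k + 1), (1 - M.law.real {ω | (A.run fb ρ T ω j).running})
      ≤ (k + 1) * (ε + n / T) := by
    refine (Finset.sum_le_card_nsmul _ _ (ε + n / T) fun j hj => hjk j ?_).trans (le_of_eq ?_)
    · rw [Finset.mem_range] at hj
      omega
    · rw [Finset.card_range, nsmul_eq_mul, Nat.cast_succ]
  have h2 : ∑ j ∈ Finset.Ico (k + 1) T, (1 - M.law.real {ω | (A.run fb ρ T ω j).running})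
      ≤ T - (k + 1) := by
    refine (Finset.sum_le_card_nsmul _ _ 1 fun j _ => ?_).trans (le_of_eq ?_)
    · linarith [measureReal_nonneg (μ := M.law) (s := {ω | (A.run fb ρ T ω j).running})]
    · rw [Nat.card_Ico, nsmul_eq_mul, mul_one, Nat.cast_sub hk.le]
      push_cast
      ring
  nlinarith

theorem expReward_eq (hT : 1 ≤ T) (hρ : ∀ i, 0 < ρ i) :
    A.expReward fb ρ T = ∑ k ∈ Finset.range T, ∫ ω, A.nextMean fb ρ T M.R k ω ∂M.law := by
  classical
  have h : ∀ ω : ℕ → Draw Θ Γ, ∑ t ∈ Finset.Icc 1 (A.stopTime fb ρ T ω),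
      M.r (ω t).1 (A.action fb ρ T ω t) (ω t).2.1
      = ∑ k ∈ Finset.range T, M.r (ω (k + 1)).1
        (A.nextAction T (A.run fb ρ T ω k) (ω (k + 1))) (ω (k + 1)).2.1 := by
    intro ω
    rw [A.sum_stopTime fb ρ T hT ω fun t => M.r (ω t).1 (A.action fb ρ T ω t) (ω t).2.1]
    refine Finset.sum_congr rfl fun k _ => ?_
    split_ifs with hr
    · rfl
    · rw [A.nextAction_of_not_running T hr, M.r_null]
  have hm : ∀ k, Measurable fun p : (ℕ → Draw Θ Γ) × Draw Θ Γ =>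
      M.r p.2.1 (A.nextAction T (A.run fb ρ T p.1 k) p.2) p.2.2.1 := fun k =>
    measurable_of_action M.measurable_r (A.measurable_nextAction fb ρ T k) measurable_snd
  unfold expReward
  simp_rw [h]
  refine (integral_finsetSum _ fun k _ => integrable_of_mem_Icc
    ((hm k).comp (measurable_id.prodMk (measurable_pi_apply (k + 1))))
    fun ω => M.r_mem _ _ _).trans ?_
  refine Finset.sum_congr rfl fun k hk => ?_
  rw [Finset.mem_range] at hk
  rw [Environment.law_eq]
  refine (integral_resample M.drawLaw (hm k) (K := 1) (fun p => ?_) (k + 1) fun ω d d' => ?_).trans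
    ?_
  · have := M.r_mem p.2.1 (A.nextAction T (A.run fb ρ T p.1 k) p.2) p.2.2.1
    exact abs_le.2 ⟨by linarith [this.1], this.2⟩
  · simp only [A.run_update fb ρ T ω (Nat.lt_succ_self k)]
  · congr 1 with ω
    exact A.integral_nextAction fb hρ M.measurable_r M.r_mem M.r_null hk ω

theorem integral_rewardError_eq (hT : 1 ≤ T) (hρ : ∀ i, 0 < ρ i) :
    ∫ ω, ∑ t ∈ Finset.Icc 1 (A.stopTime fb ρ T ω), A.rewardError fb ρ T ω t ∂M.law
      = ∑ k ∈ Finset.range T, ∫ ω, A.runValue fb ρ T k ω ∂M.law - A.expReward fb ρ T := by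
  classical
  have h : ∀ ω : ℕ → Draw Θ Γ,
      ∑ t ∈ Finset.Icc 1 (A.stopTime fb ρ T ω), A.rewardError fb ρ T ω t
      = ∑ k ∈ Finset.range T, (A.runValue fb ρ T k ω - A.nextMean fb ρ T M.R k ω) := by
    intro ω
    rw [A.sum_stopTime fb ρ T hT ω]
    refine Finset.sum_congr rfl fun k _ => ?_
    have hrho : A.rho fb ρ T ω (k + 1) = nextRho T (A.run fb ρ T ω k) := by
      ext i
      simp only [rho, nextRho]
      push_cast
      congr 1
      ring
    unfold runValue
    split_ifs with hr
    · rw [rewardError, hrho]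
      rfl
    · simp [nextMean, A.nextProb_of_not_running T hr]
  have hi : ∀ k ∈ Finset.range T, Integrable (A.nextMean fb ρ T M.R k) M.law := fun k hk =>
    integrable_of_mem_Icc (A.measurable_nextMean fb ρ T M.measurable_R k)
      (A.nextMean_mem fb hρ M.measurable_R M.R_mem (Finset.mem_range.1 hk))
  have hi' : ∀ k ∈ Finset.range T, Integrable (A.runValue fb ρ T k) M.law := fun k hk =>
    A.integrable_runValue fb hρ (Finset.mem_range.1 hk)
  simp_rw [h]
  refine (integral_finsetSum _ fun k hk => (hi' k hk).sub (hi k hk)).trans ?_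
  rw [A.expReward_eq fb hT hρ, ← Finset.sum_sub_distrib]
  exact Finset.sum_congr rfl fun k hk => integral_sub (hi' k hk) (hi k hk)

/-- Decomposition of the regret into the loss of fluid value while running, the rounds missed
because of stopping, and the reward estimation error. -/
theorem regret_eq (hT : 1 ≤ T) (hρ : ∀ i, 0 < ρ i) :
    M.fluid ρ T - A.expReward fb ρ T
      = ∑ k ∈ Finset.range T, ∫ ω, A.runLoss fb ρ T k ω ∂M.law
        + M.J ρ * ∑ k ∈ Finset.range T, (1 - M.law.real {ω | (A.run fb ρ T ω k).running})
        + ∫ ω, ∑ t ∈ Finset.Icc 1 (A.stopTime fb ρ T ω), A.rewardError fb ρ T ω t ∂M.law := by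
  rw [A.integral_rewardError_eq fb hT hρ, Finset.sum_congr rfl fun k hk =>
    A.integral_runLoss fb hρ (Finset.mem_range.1 hk), Finset.sum_sub_distrib,
    Finset.sum_sub_distrib, ← Finset.mul_sum, Environment.fluid]
  simp only [Finset.sum_const, Finset.card_range, nsmul_eq_mul, mul_one]
  ring

/-- The expected total loss of fluid value while running. -/
theorem sum_runLoss_le {m : ℝ} (hm : 0 < m) (hm1 : m ≤ 1) (hρ : ∀ i, m ≤ ρ i) (hn : 1 ≤ n)
    (hT : 1 ≤ T) {err : ℕ → ℝ → ℝ}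
    (herr0 : ∀ t ∈ Finset.Icc 1 (T - 1), ∀ ε : ℝ, 0 < ε → 0 ≤ err t ε)
    (herr : A.ConsumptionErrorBound fb ρ T err) :
    ∑ k ∈ Finset.range T, ∫ ω, A.runLoss fb ρ T k ω ∂M.law
      ≤ 2 / m * (∑ t ∈ Finset.Icc 1 (T - 1), errInf err t + 2 * √(2 * T * Real.log T) + n) := by
  have hρ0 : ∀ i, 0 < ρ i := fun i => hm.trans_le (hρ i)
  have hn' : (1 : ℝ) ≤ n := by exact_mod_cast hn
  have hT' : (1 : ℝ) ≤ T := by exact_mod_cast hT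
  have hk : ∀ k ∈ Finset.range (T - 1), ∫ ω, A.runLoss fb ρ T k ω ∂M.law
      ≤ (errInf err (k + 1) + radius T k + n / T) / m := by
    intro k hk
    rw [Finset.mem_range] at hk
    -- Isolating the part that depends on `ε` lets the infimum over `ε` be taken on one side.
    have h : m * (∫ ω, A.runLoss fb ρ T k ω ∂M.law) - radius T k - n / T
        ≤ errInf err (k + 1) := by
      have : Nonempty (Set.Ioi (0 : ℝ)) := ⟨⟨1, Set.mem_Ioi.2 one_pos⟩⟩
      refine le_ciInf fun ε => ?_
      have h := A.integral_runLoss_le fb hm hm1 hρ herr (by omega : k + 1 < T) ε.2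
        (herr0 (k + 1) (Finset.mem_Icc.2 ⟨by omega, by omega⟩) ε ε.2)
      rw [le_div_iff₀ hm] at h
      linarith
    rw [le_div_iff₀ hm]
    linarith
  -- The error hypothesis does not cover round `T`; its loss is bounded trivially by `1`.
  have hlast := A.integral_runLoss_le_one fb hρ0 (by omega : T - 1 < T)
  have hnonneg : 0 ≤ ∑ t ∈ Finset.Icc 1 (T - 1), errInf err t :=
    Finset.sum_nonneg fun t ht => Real.iInf_nonneg fun ε =>
      add_nonneg (herr0 t ht ε ε.2) (le_of_lt ε.2)
  have hsum := Finset.sum_le_sum hk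
  rw [← Finset.sum_div, Finset.sum_add_distrib, Finset.sum_add_distrib,
    ← sum_Icc_one_eq_sum_range (errInf err), Finset.sum_const, Finset.card_range,
    nsmul_eq_mul] at hsum
  have hrad := sum_radius_le T hT
  have hnT : ((T - 1 : ℕ) : ℝ) * (n / T) ≤ n := by
    have h1 : ((T - 1 : ℕ) : ℝ) ≤ T := by exact_mod_cast Nat.sub_le T 1
    calc ((T - 1 : ℕ) : ℝ) * (n / T) ≤ T * (n / T) :=
          mul_le_mul_of_nonneg_right h1 (by positivity)
      _ = n := by field_simp
  have hsplit : ∑ k ∈ Finset.range T, ∫ ω, A.runLoss fb ρ T k ω ∂M.law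
      = ∑ k ∈ Finset.range (T - 1), ∫ ω, A.runLoss fb ρ T k ω ∂M.law
        + ∫ ω, A.runLoss fb ρ T (T - 1) ω ∂M.law := by
    rw [← Finset.sum_range_succ, Nat.sub_add_cancel hT]
  have hone : (1 : ℝ) ≤ 1 / m := (one_le_div hm).2 hm1
  have hsqrt : 0 ≤ √(2 * T * Real.log T) := Real.sqrt_nonneg _
  rw [hsplit]
  calc _ ≤ (∑ t ∈ Finset.Icc 1 (T - 1), errInf err t + 2 * √(2 * T * Real.log T) + n) / m
        + 1 / m := by
        refine add_le_add (hsum.trans (div_le_div_of_nonneg_right ?_ hm.le)) (hlast.trans hone)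
        linarith
    -- The extra `1` from the last round is absorbed by `n ≥ 1`; this is the source of the factor
    -- `2`.
    _ ≤ _ := by
        rw [← add_div, div_mul_eq_mul_div]
        refine div_le_div_of_nonneg_right ?_ hm.le
        linarith

end Resolver

end CBwK

/-! ### Assembly of the regret bound. -/

theorem mainTheorem5 (ρmin : ℝ) (hρmin : 0 < ρmin) :
    ∃ C₁ C₂ : ℝ, 0 < C₁ ∧ 0 < C₂ ∧
      ∀ (n : ℕ) (Θ Γ : Type*) [MeasurableSpace Θ] [MeasurableSpace Γ]
        (M : CBwK.Environment n Θ Γ) (ρ : Fin n → ℝ) (_ : ∀ i, 0 < ρ i ∧ ρ i ≤ 1)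
        (_ : IsLeast (Set.range ρ) ρmin)
        (T : ℕ) (_ : 1 ≤ T) (fb : CBwK.Feedback) (A : CBwK.Resolver M)
        (err : ℕ → ℝ → ℝ) (_ : ∀ t ∈ Finset.Icc 1 (T - 1), ∀ ε : ℝ, 0 < ε → 0 ≤ err t ε)
        (fR : ℕ → ℝ),
        A.ConsumptionErrorBound fb ρ T err →
        A.RewardErrorBound fb ρ T (fR T) →
        ((M.fluid ρ T - A.expReward fb ρ T : ℝ) : EReal) ≤
          ((C₁ * (∑ t ∈ Finset.Icc 1 (T - 1), CBwK.errInf err t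
              + 2 * √(2 * T * Real.log T) + n) : ℝ) : EReal)
            + (C₂ : EReal) * CBwK.earlyStop n ρmin err T + ((fR T : ℝ) : EReal) := by
  -- `C₁` comes from the stability constant `1 / ρmin`, doubled for the last round; `C₂ = 1` because
  -- `J(ρ) ≤ 1`.
  refine ⟨2 / ρmin, 1, by positivity, one_pos, ?_⟩
  intro n Θ Γ _ _ M ρ hρ hleast T hT fb A err herr0 fR hC hR
  obtain ⟨i₀, hi₀⟩ := hleast.1
  have hn : 1 ≤ n := Nat.one_le_iff_ne_zero.2 fun h => by
    subst h
    exact i₀.elim0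
  have hρ0 : ∀ i, 0 < ρ i := fun i => (hρ i).1
  have hm : ∀ i, ρmin ≤ ρ i := fun i => hleast.2 ⟨i, rfl⟩
  have hloss := A.sum_runLoss_le fb hρmin (hi₀ ▸ (hρ i₀).2) hm hn hT herr0 hC
  have hmissed : ((∑ k ∈ Finset.range T,
      (1 - M.law.real {ω | (A.run fb ρ T ω k).running}) : ℝ) : EReal)
      ≤ CBwK.earlyStop n ρmin err T := by
    -- If no pair is admissible the infimum is `⊤`, and there is nothing to check.
    refine le_sInf ?_
    rintro x ⟨t, ε, ht1, htT, hε, h, rfl⟩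
    obtain ⟨k, rfl⟩ : ∃ k, t = k + 1 := ⟨t - 1, by omega⟩
    rw [EReal.coe_le_coe_iff]
    push_cast at h ⊢
    exact A.sum_not_running_le fb hρ0 hm hC htT hε h
  have hJ := M.J_mem fun i => (hρ0 i).le
  have hnr : 0 ≤ ∑ k ∈ Finset.range T, (1 - M.law.real {ω | (A.run fb ρ T ω k).running}) :=
    Finset.sum_nonneg fun k _ => sub_nonneg.2 measureReal_le_one
  rw [EReal.coe_one, one_mul]
  refine le_trans ?_ (add_le_add (add_le_add le_rfl hmissed) le_rfl)
  rw [← EReal.coe_add, ← EReal.coe_add, EReal.coe_le_coe_iff, A.regret_eq fb hT hρ0]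
  exact add_le_add (add_le_add hloss (mul_le_of_le_one_left hnr hJ.2)) hR
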